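/- Let $\mathbb{K}$ be $\mathbb{R}$ or $\mathbb{C}$, let $V$ be a finite-dimensional vector space over $\mathbb{K}$ and let $\mathcal{P} = \{A_\mu = A + \mu B \mid \mu \in \mathbb{K}\cup\{\infty\}\}$, $A_\infty = B$, be a pencil of skew-symmetric bilinear forms on $V$. Its rank is $\operatorname{rk}\mathcal{P} = \max_{\mu} \operatorname{rk} A_\mu$. A subspace $L \subset V$ is called bi-Lagrangian if $A_\mu(u,v) = 0$ for all $u, v \in L$ and all $\mu \in \mathbb{K}\cup\{\infty\}$, and $\dim L = \dim V - \frac12 \operatorname{rk}\mathcal{P}$. The set of all bi-Lagrangian subspaces is the bi-Lagrangian Grassmannian $\operatorname{BLG}(V,\mathcal{P})$; it is a projective subvariety of the Grassmannian of subspaces of $V$ of dimension $\dim V - \frac12\operatorname{rk}\mathcal{P}$, and its dimension is its dimension as an algebraic variety over $\mathbb{K}$ (the Krull dimension of its set of points in the Zariski topology). For $\lambda \in \mathbb{K}$ and $n \ge 1$ let $\mathcal{J}_{\lambda,2n}$ denote the $2n$-dimensional space $\mathbb{K}^{2n}$ with the pencil generated by the forms with the matrices $$A = \begin{pmatrix}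 0 & J_\lambda \\ -J_\lambda^T & 0\end{pmatrix}, \qquad B = \begin{pmatrix} 0 & I_n \\ -I_n & 0\end{pmatrix},$$ where $J_\lambda$ is the $n\times n$ upper triangular Jordan block with eigenvalue $\lambda$; for $\lambda = \infty$ take instead $A = \begin{pmatrix} 0 & I_n \\ -I_n & 0\end{pmatrix}$ and $B = \begin{pmatrix} 0 & J_0 \\ -J_0^T & 0\end{pmatrix}$. Suppose that $(V,\mathcal{P})$ is isomorphic to a bi-orthogonal direct sum of Jordan blocks with one and the same eigenvalue $\lambda \in \mathbb{K}\cup\{\infty\}$, $$(V,\mathcal{P}) = \bigoplus_{j=1}^N \mathcal{J}_{\lambda, 2n_j}, \qquad n_1 \ge n_2 \ge \dots \ge n_N .$$ Then $$\dim \operatorname{BLG}(V,\mathcal{P}) = \sum_{j=1}^N j\cdot n_j .$$ -/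

import Mathlib

/-- A pencil `{A + μ B}` of 2-forms on a vector space `V`, given by two generating skew-symmetric
bilinear forms; `V` together with such a pencil is a bi-Poisson vector space. -/
structure SkewPencil (K V : Type*) [Field K] [AddCommGroup V] [Module K V] where
  /-- the form at the parameter `0` -/
  A : LinearMap.BilinForm K V
  /-- the form at the parameter `∞` -/
  B : LinearMap.BilinForm K V
  isAlt_A : A.IsAlt
  isAlt_B : B.IsAlt

namespace SkewPencil

section Forms

variable {K V : Type*} [Field K] [AddCommGroup V] [Module K V]

/-- The form `A + μ B` of the pencil with parameter `μ ∈ K ∪ {∞}`; at `μ = ∞` it is `B`. -/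
def form (P : SkewPencil K V) : OnePoint K → LinearMap.BilinForm K V
  | none => P.B
  | some μ => P.A + μ • P.B

/-- The rank of the pencil: the maximum over `μ ∈ K ∪ {∞}` of the rank of the form at `μ`
(the ranks are bounded by `dim V`, so the supremum in `ℕ` is a maximum). -/
noncomputable def rank (P : SkewPencil K V) : ℕ :=
  ⨆ μ : OnePoint K, Module.finrank K (LinearMap.range (P.form μ))

/-- All forms of the pencil vanish on `U`. -/
def IsBiIsotropic (P : SkewPencil K V) (U : Submodule K V) : Prop :=
  ∀ μ : OnePoint K, ∀ u ∈ U, ∀ v ∈ U, P.form μ u v = 0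

/-- `U` is bi-isotropic and `dim U = dim V - (1/2) rank P`. -/
def IsBiLagrangian (P : SkewPencil K V) (U : Submodule K V) : Prop :=
  P.IsBiIsotropic U ∧ 2 * Module.finrank K U + P.rank = 2 * Module.finrank K V

end Forms

end SkewPencil

/-- The Zariski topology on (the points of) a vector space `W`: the closed sets are the common
zero sets of families of polynomial functions, i.e. of polynomials in linear functionals. -/
@[reducible] noncomputable def zariskiTopology (K W : Type*) [Field K] [AddCommGroup W] [Module K W] :
    TopologicalSpace W :=
  TopologicalSpace.induced
    (fun w => MvPolynomial.pointToPoint (k := K) (K := K)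
      (fun φ : Module.Dual K W => φ w))
    PrimeSpectrum.zariskiTopology

/-- The Grassmannian of `k`-dimensional subspaces of `V`. -/
def Gr (K V : Type*) [Field K] [AddCommGroup V] [Module K V] (k : ℕ) : Type _ :=
  {L : Submodule K V // Module.finrank K L = k}

/-- The `k`-frames in `V`: the linearly independent `k`-tuples of vectors. -/
def Frames (K V : Type*) [Field K] [AddCommGroup V] [Module K V] (k : ℕ) : Type _ :=
  {v : Fin k → V // LinearIndependent K v}

/-- The subspace spanned by a frame. -/
noncomputable def Frames.span {K V : Type*} [Field K] [AddCommGroup V] [Module K V] {k : ℕ}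
    (v : Frames K V k) : Gr K V k :=
  ⟨Submodule.span K (Set.range v.1), by simpa using finrank_span_eq_card v.2⟩

/-- The Zariski topology on the space of frames, a subspace of `V ^ k`. -/
noncomputable instance Frames.topology (K V : Type*) [Field K] [AddCommGroup V] [Module K V]
    (k : ℕ) : TopologicalSpace (Frames K V k) :=
  TopologicalSpace.induced Subtype.val (zariskiTopology K (Fin k → V))

/-- The Zariski topology on the Grassmannian, as the quotient of the space of frames by `GL_k`:
a set of subspaces is closed iff the set of the frames spanning its members is closed. -/
noncomputable instance Gr.topology (K V : Type*) [Field K] [AddCommGroup V] [Module K V]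
    (k : ℕ) : TopologicalSpace (Gr K V k) :=
  TopologicalSpace.coinduced Frames.span inferInstance

namespace SkewPencil

section Grassmannian

variable {K V : Type*} [Field K] [AddCommGroup V] [Module K V]

/-- The bi-Lagrangian Grassmannian: the set of all bi-Lagrangian subspaces. -/
def BLG (P : SkewPencil K V) : Type _ :=
  {L : Submodule K V // P.IsBiLagrangian L}

/-- The inclusion of the bi-Lagrangian Grassmannian into the Grassmannian of subspaces of
dimension `dim V - (1/2) rank P`. -/
def BLG.toGr (P : SkewPencil K V) (L : P.BLG) :
    Gr K V (Module.finrank K V - P.rank / 2) :=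
  ⟨L.1, by have h := L.2.2; omega⟩

/-- The bi-Lagrangian Grassmannian carries the Zariski topology of a subvariety of the
Grassmannian; its dimension as a variety is its Krull dimension `topologicalKrullDim P.BLG`. -/
noncomputable instance BLG.topology (P : SkewPencil K V) : TopologicalSpace P.BLG :=
  TopologicalSpace.induced (BLG.toGr P) inferInstance

end Grassmannian

end SkewPencil

/-- The `n × n` upper triangular Jordan block with eigenvalue `μ`. -/
def jordanMatrix {K : Type*} [Field K] (μ : K) (n : ℕ) : Matrix (Fin n) (Fin n) K :=
  Matrix.of fun i j => if i = j then μ else if (i : ℕ) + 1 = (j : ℕ) then 1 else 0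

/-- The skew-symmetric matrix with off-diagonal blocks `X` and `-Xᵀ`. -/
def skewBlock {K : Type*} [Field K] {n : ℕ} (X : Matrix (Fin n) (Fin n) K) :
    Matrix (Fin n ⊕ Fin n) (Fin n ⊕ Fin n) K :=
  Matrix.fromBlocks 0 X (-X.transpose) 0

/-- The matrix of the form `A` in the `2n`-dimensional Jordan block with eigenvalue `lam`. -/
def jordanBlockA {K : Type*} [Field K] (lam : OnePoint K) (n : ℕ) :
    Matrix (Fin n ⊕ Fin n) (Fin n ⊕ Fin n) K :=
  match lam with
  | none => skewBlock 1
  | some μ => skewBlock (jordanMatrix μ n)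

/-- The matrix of the form `B` in the `2n`-dimensional Jordan block with eigenvalue `lam`. -/
def jordanBlockB {K : Type*} [Field K] (lam : OnePoint K) (n : ℕ) :
    Matrix (Fin n ⊕ Fin n) (Fin n ⊕ Fin n) K :=
  match lam with
  | none => skewBlock (jordanMatrix 0 n)
  | some _ => skewBlock 1

/-- `(V, P)` is the (bi-orthogonal) direct sum of the Jordan blocks of dimensions `2 * n j` with
the common eigenvalue `lam ∈ K ∪ {∞}`: in some basis both forms are block diagonal with the
standard blocks. -/
def SkewPencil.IsJordanSum {K V : Type*} [Field K] [AddCommGroup V] [Module K V]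
    (P : SkewPencil K V) (lam : OnePoint K) {N : ℕ} (n : Fin N → ℕ) : Prop :=
  ∃ b : Module.Basis (Σ j : Fin N, Fin (n j) ⊕ Fin (n j)) K V,
    LinearMap.BilinForm.toMatrix b P.A = Matrix.blockDiagonal' (fun j => jordanBlockA lam (n j)) ∧
    LinearMap.BilinForm.toMatrix b P.B = Matrix.blockDiagonal' (fun j => jordanBlockB lam (n j))

/-! Some form `ω` of the pencil is nondegenerate (`B` for finite eigenvalue, `A` for the eigenvalue
`∞`), and the pencil is spanned by `ω` and `η(u, v) = ω(x u, v)` with `x` nilpotent and self-adjoint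
for `ω`. So the rank is `dim V`, and since a Lagrangian `L` is its own `ω`-orthogonal, `η` vanishes
on `L` exactly when `x L ⊆ L`. The bi-Lagrangian subspaces are therefore the invariant Lagrangian
submodules of the symplectic `K[x]`-module `⨁ (K[x] / x ^ n j) ^ 2`. The target number is `∑_{i ≤ j}
min (n i) (n j)`, half of `lagWeight n`.

Upper bound: `L` is built up from `0` by adding socle lines. If `Z ⊆ L` is an isotropic submodule
and `Z^⊥ / Z` has type `n`, then `L / Z` contains a socle vector `x ^ (n j - 1) g`, where `g` is a
generator of order `n j` plus multiples of generators of at least that order. This costs at most as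
many parameters as there are `i` with `n i ≥ n j`. Adding the vector to `Z` lowers `n j` by one, and
half of `lagWeight` drops by exactly that number (`lagWeight_update`). Thus finitely many polynomial
maps from `K ^ d`, `d = lagWeight n / 2`, cover everything (`isParametrized_of_frames`). A chain of
irreducible closed sets of length `r` yields `r` functions independent modulo a prime ideal, whereas
any `d + 1` functions become dependent on each image of `K ^ d` (`krullDim_le_of_isParametrized`).

Lower bound: the graphs of symmetric `K[x]`-bilinear forms on `⨁ K[x] / x ^ n j` form an affine
space of dimension `d` of bi-Lagrangian subspaces, given by Hankel matrices. Its coordinate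
subspaces yield a chain of length `d` (`le_krullDim_of_polynomial_family`). -/

/-! ### Polynomial functions and the Zariski topology of a vector space. -/

section PolyFun

variable (K : Type*) [Field K]

/-- The algebra of polynomial functions on a vector space. -/
def polyFun (W : Type*) [AddCommGroup W] [Module K W] : Subalgebra K (W → K) :=
  Algebra.adjoin K {f | ∃ φ : Module.Dual K W, f = fun w => φ w}

variable {K}
variable {U V W : Type*} [AddCommGroup U] [Module K U] [AddCommGroup V] [Module K V]
  [AddCommGroup W] [Module K W]

theorem dual_mem_polyFun (φ : Module.Dual K W) : (fun w => φ w) ∈ polyFun K W :=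
  Algebra.subset_adjoin ⟨φ, rfl⟩

theorem const_mem_polyFun (c : K) : (fun _ : W => c) ∈ polyFun K W :=
  (polyFun K W).algebraMap_mem c

/-- A map between vector spaces all of whose coordinates are polynomial functions. -/
def IsPolyMap (g : W → V) : Prop :=
  ∀ φ : Module.Dual K V, (fun w => φ (g w)) ∈ polyFun K W

theorem IsPolyMap.comp_mem {g : W → V} (hg : IsPolyMap (K := K) g) {f : V → K}
    (hf : f ∈ polyFun K V) : (fun w => f (g w)) ∈ polyFun K W := by
  induction hf using Algebra.adjoin_induction with
  | mem f hf => obtain ⟨φ, rfl⟩ := hf; exact hg φ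
  | algebraMap r => exact const_mem_polyFun r
  | add f g _ _ hf hg => exact add_mem hf hg
  | mul f g _ _ hf hg => exact mul_mem hf hg

theorem IsPolyMap.comp {g : W → V} {h : U → W} (hg : IsPolyMap (K := K) g)
    (hh : IsPolyMap (K := K) h) : IsPolyMap (K := K) (fun u => g (h u)) :=
  fun φ => hh.comp_mem (hg φ)

theorem isPolyMap_linear (ℓ : W →ₗ[K] V) : IsPolyMap (K := K) (fun w => ℓ w) :=
  fun φ => dual_mem_polyFun (φ.comp ℓ)

theorem isPolyMap_const (v : V) : IsPolyMap (K := K) (fun _ : W => v) :=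
  fun φ => const_mem_polyFun (φ v)

theorem IsPolyMap.add {g h : W → V} (hg : IsPolyMap (K := K) g) (hh : IsPolyMap (K := K) h) :
    IsPolyMap (K := K) (fun w => g w + h w) := fun φ => by
  have h := add_mem (hg φ) (hh φ)
  simp only [map_add]
  exact h

theorem IsPolyMap.linear_comp {g : W → V} (hg : IsPolyMap (K := K) g) (ℓ : V →ₗ[K] U) :
    IsPolyMap (K := K) (fun w => ℓ (g w)) := (isPolyMap_linear ℓ).comp hg

theorem IsPolyMap.neg {g : W → V} (hg : IsPolyMap (K := K) g) :
    IsPolyMap (K := K) (fun w => -g w) := hg.linear_comp (-LinearMap.id)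

theorem IsPolyMap.sub {g h : W → V} (hg : IsPolyMap (K := K) g) (hh : IsPolyMap (K := K) h) :
    IsPolyMap (K := K) (fun w => g w - h w) := by
  simpa only [sub_eq_add_neg] using hg.add hh.neg

theorem IsPolyMap.smul {c : W → K} {g : W → V} (hc : c ∈ polyFun K W)
    (hg : IsPolyMap (K := K) g) : IsPolyMap (K := K) (fun w => c w • g w) := fun φ => by
  have h := mul_mem hc (hg φ)
  simp only [map_smul]
  exact h

theorem IsPolyMap.sum {ι : Type*} (s : Finset ι) {g : ι → W → V}
    (hg : ∀ i ∈ s, IsPolyMap (K := K) (g i)) :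
    IsPolyMap (K := K) (fun w => ∑ i ∈ s, g i w) := fun φ => by
  have h := sum_mem (S := polyFun K W) (t := s) (f := fun i => fun w => φ (g i w))
    (fun i hi => hg i hi φ)
  convert h using 1
  ext w
  simp

theorem IsPolyMap.pi {κ : Type*} [Finite κ] {g : W → κ → V}
    (hg : ∀ i, IsPolyMap (K := K) (fun w => g w i)) : IsPolyMap (K := K) g := by
  classical
  have := Fintype.ofFinite κ
  have h : g = fun w => ∑ i, LinearMap.single K (fun _ : κ => V) i (g w i) := by
    ext w j
    simp [Finset.sum_apply, Pi.single_apply]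
  rw [h]
  exact IsPolyMap.sum _ fun i _ => (hg i).linear_comp _

theorem exists_eval_of_mem_polyFun {σ : Type*} [Finite σ] {f : (σ → K) → K}
    (hf : f ∈ polyFun K (σ → K)) : ∃ p : MvPolynomial σ K, ∀ s, f s = MvPolynomial.eval s p := by
  classical
  have := Fintype.ofFinite σ
  induction hf using Algebra.adjoin_induction with
  | mem f hf =>
    obtain ⟨φ, rfl⟩ := hf
    refine ⟨∑ i, MvPolynomial.C (φ (Pi.single i 1)) * MvPolynomial.X i, fun s => ?_⟩
    simp only [map_sum, map_mul, MvPolynomial.eval_C, MvPolynomial.eval_X]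
    conv_lhs => rw [LinearMap.pi_apply_eq_sum_univ φ s]
    refine Finset.sum_congr rfl fun i _ => ?_
    rw [smul_eq_mul, mul_comm]
    congr 2
    ext j
    simp [Pi.single_apply, eq_comm]
  | algebraMap r => exact ⟨MvPolynomial.C r, fun s => by simp⟩
  | add f g _ _ hf hg =>
    obtain ⟨p, hp⟩ := hf
    obtain ⟨q, hq⟩ := hg
    exact ⟨p + q, fun s => by simp [hp, hq]⟩
  | mul f g _ _ hf hg =>
    obtain ⟨p, hp⟩ := hf
    obtain ⟨q, hq⟩ := hg
    exact ⟨p * q, fun s => by simp [hp, hq]⟩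

/-- The variables are all the linear functionals, to match the definition of `zariskiTopology`. -/
theorem exists_eval_dual_of_mem_polyFun {f : W → K} (hf : f ∈ polyFun K W) :
    ∃ p : MvPolynomial (Module.Dual K W) K, ∀ w, f w = MvPolynomial.eval (fun φ => φ w) p := by
  induction hf using Algebra.adjoin_induction with
  | mem f hf =>
    obtain ⟨φ, rfl⟩ := hf
    exact ⟨MvPolynomial.X φ, fun w => by simp⟩
  | algebraMap r => exact ⟨MvPolynomial.C r, fun s => by simp⟩
  | add f g _ _ hf hg =>
    obtain ⟨p, hp⟩ := hf
    obtain ⟨q, hq⟩ := hg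
    exact ⟨p + q, fun s => by simp [hp, hq]⟩
  | mul f g _ _ hf hg =>
    obtain ⟨p, hp⟩ := hf
    obtain ⟨q, hq⟩ := hg
    exact ⟨p * q, fun s => by simp [hp, hq]⟩

theorem eval_dual_mem_polyFun (p : MvPolynomial (Module.Dual K W) K) :
    (fun w => MvPolynomial.eval (fun φ : Module.Dual K W => φ w) p) ∈ polyFun K W := by
  induction p using MvPolynomial.induction_on with
  | C a => simpa using const_mem_polyFun a
  | add p q hp hq => 
    have h := add_mem hp hq
    simp only [map_add]
    exact h
  | mul_X p φ hp =>
    have h := mul_mem hp (dual_mem_polyFun φ)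
    simp only [map_mul, MvPolynomial.eval_X]
    exact h

theorem isClosed_zariskiTopology_iff {C : Set W} :
    @IsClosed W (zariskiTopology K W) C ↔
      ∃ S ⊆ (polyFun K W : Set (W → K)), C = {w | ∀ f ∈ S, f w = 0} := by
  rw [isClosed_induced_iff]
  constructor
  · rintro ⟨T, hT, rfl⟩
    obtain ⟨s, rfl⟩ := (PrimeSpectrum.isClosed_iff_zeroLocus T).1 hT
    refine ⟨(fun p w => MvPolynomial.eval (fun φ : Module.Dual K W => φ w) p) '' s, ?_, ?_⟩
    · rintro _ ⟨p, -, rfl⟩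
      exact eval_dual_mem_polyFun p
    · ext w
      simp [PrimeSpectrum.mem_zeroLocus, MvPolynomial.pointToPoint, Set.subset_def,
        MvPolynomial.aeval_eq_eval]
  · rintro ⟨S, hS, rfl⟩
    refine ⟨PrimeSpectrum.zeroLocus {p | ∃ f ∈ S, ∀ w, f w =
      MvPolynomial.eval (fun φ : Module.Dual K W => φ w) p},
      PrimeSpectrum.isClosed_zeroLocus _, ?_⟩
    ext w
    simp only [Set.mem_preimage, PrimeSpectrum.mem_zeroLocus, MvPolynomial.pointToPoint,
      Set.subset_def, Set.mem_ofPred_eq, SetLike.mem_coe, MvPolynomial.mem_vanishingIdeal_iff,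
      Set.mem_singleton_iff, forall_eq, MvPolynomial.aeval_eq_eval]
    constructor
    · intro h f hf
      obtain ⟨p, hp⟩ := exists_eval_dual_of_mem_polyFun (hS hf)
      rw [hp]
      exact h p ⟨f, hf, hp⟩
    · rintro h p ⟨f, hf, hp⟩
      rw [← h f hf, hp]

/-- `h` becomes polynomial on `δ ≠ 0` after multiplication with a power of `δ`. -/
def IsRegularOff (δ h : W → K) : Prop :=
  ∃ N : ℕ, ∃ q ∈ polyFun K W, ∀ w, δ w ≠ 0 → δ w ^ N * h w = q w

theorem IsRegularOff.of_mem {δ h : W → K} (hh : h ∈ polyFun K W) : IsRegularOff δ h :=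
  ⟨0, h, hh, fun w _ => by simp⟩

theorem IsRegularOff.add {δ g h : W → K} (hδ : δ ∈ polyFun K W) (hg : IsRegularOff δ g)
    (hh : IsRegularOff δ h) : IsRegularOff δ (fun w => g w + h w) := by
  obtain ⟨M, p, hp, hgp⟩ := hg
  obtain ⟨N, q, hq, hhq⟩ := hh
  refine ⟨M + N, fun w => δ w ^ N * p w + δ w ^ M * q w,
    add_mem (mul_mem (pow_mem hδ N) hp) (mul_mem (pow_mem hδ M) hq), fun w hw => ?_⟩
  simp only
  rw [← hgp w hw, ← hhq w hw]
  ring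

theorem IsRegularOff.mul {δ g h : W → K} (hg : IsRegularOff δ g)
    (hh : IsRegularOff δ h) : IsRegularOff δ (fun w => g w * h w) := by
  obtain ⟨M, p, hp, hgp⟩ := hg
  obtain ⟨N, q, hq, hhq⟩ := hh
  refine ⟨M + N, fun w => p w * q w, mul_mem hp hq, fun w hw => ?_⟩
  simp only
  rw [← hgp w hw, ← hhq w hw]
  ring

theorem IsRegularOff.comp_of_mem {δ : W → K} (hδ : δ ∈ polyFun K W) {g : W → V}
    (hg : ∀ φ : Module.Dual K V, IsRegularOff δ (fun w => φ (g w))) {f : V → K}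
    (hf : f ∈ polyFun K V) : IsRegularOff δ (fun w => f (g w)) := by
  induction hf using Algebra.adjoin_induction with
  | mem f hf => obtain ⟨φ, rfl⟩ := hf; exact hg φ
  | algebraMap r => exact IsRegularOff.of_mem (const_mem_polyFun r)
  | add f g _ _ hf hg => exact hf.add hδ hg
  | mul f g _ _ hf hg => exact hf.mul hg

/-- Irreducibility of affine space: over an infinite field a polynomial is determined by its values,
and the polynomial ring is a domain. -/
theorem eq_zero_or_eq_zero_of_mul_polyFun [Infinite K] {σ : Type*} [Finite σ]
    {f g : (σ → K) → K} (hf : f ∈ polyFun K (σ → K)) (hg : g ∈ polyFun K (σ → K))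
    (h : ∀ s, f s = 0 ∨ g s = 0) : f = 0 ∨ g = 0 := by
  obtain ⟨p, hp⟩ := exists_eval_of_mem_polyFun hf
  obtain ⟨q, hq⟩ := exists_eval_of_mem_polyFun hg
  have hpq : p * q = 0 := by
    apply MvPolynomial.funext
    intro s
    rw [map_mul, ← hp, ← hq, map_zero, mul_eq_zero]
    exact h s
  rcases mul_eq_zero.1 hpq with rfl | rfl
  · exact Or.inl (funext fun s => by simp [hp])
  · exact Or.inr (funext fun s => by simp [hq])

end PolyFun

/-! ### Algebraic dependence and chains of primes. -/

section Dependence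

variable {K : Type*} [Field K]

/-- In `K ^ d`, any `d + 1` fractions of polynomial functions with the same denominator satisfy
a nontrivial polynomial relation. -/
theorem exists_relation_of_fractions [Infinite K] {d : ℕ} {δ : (Fin d → K) → K}
    (hδ : δ ∈ polyFun K (Fin d → K)) {h : Fin (d + 1) → (Fin d → K) → K}
    (hh : ∀ l, IsRegularOff δ (h l)) :
    ∃ F : MvPolynomial (Fin (d + 1)) K, F ≠ 0 ∧
      ∀ s, δ s ≠ 0 → MvPolynomial.eval (fun l => h l s) F = 0 := by
  obtain ⟨D, hD⟩ := exists_eval_of_mem_polyFun hδ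
  by_cases hD0 : D = 0
  -- If the denominator vanishes identically, no point satisfies `δ s ≠ 0`.
  · exact ⟨1, one_ne_zero, fun s hs => absurd (by simp [hD, hD0]) hs⟩
  choose N q hq hhq using hh
  choose p hp using fun l => exists_eval_of_mem_polyFun (hq l)
  let L := Localization.Away D
  have hM : Submonoid.powers D ≤ nonZeroDivisors (MvPolynomial (Fin d) K) :=
    powers_le_nonZeroDivisors_of_noZeroDivisors hD0
  have : IsDomain L := IsLocalization.isDomain_localization hM
  have hinj : Function.Injective (algebraMap (MvPolynomial (Fin d) K) L) :=
    IsLocalization.injective L hM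
  let y : Fin (d + 1) → L := fun l =>
    IsLocalization.mk' L (p l) (⟨D ^ N l, N l, rfl⟩ : Submonoid.powers D)
  -- Inverting `D` is an algebraic extension of `K[X_1, …, X_d]`, so the transcendence degree stays
  -- `d`, too small for `d + 1` independent fractions.
  have htr : Algebra.trdeg K L ≤ d := by
    have halg : Algebra.IsAlgebraic (MvPolynomial (Fin d) K) L :=
      IsLocalization.isAlgebraic _ (Submonoid.powers D)
    have : FaithfulSMul (MvPolynomial (Fin d) K) L := (faithfulSMul_iff_algebraMap_injective _ _).2 hinj
    have h1 := trdeg_add_eq K (MvPolynomial (Fin d) K) (A := L)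
    rw [MvPolynomial.trdeg_of_isDomain, trdeg_eq_zero (R := MvPolynomial (Fin d) K)] at h1
    rw [← h1]
    simp
  have hnot : ¬ AlgebraicIndependent K y := by
    intro hy
    have h1 := hy.lift_cardinalMk_le_trdeg
    have h2 : (Cardinal.lift (Cardinal.mk (Fin (d + 1)))) ≤ Cardinal.lift (d : Cardinal) :=
      h1.trans (Cardinal.lift_le.2 htr)
    simp at h2
  rw [algebraicIndependent_iff] at hnot
  push Not at hnot
  obtain ⟨F, hF, hF0⟩ := hnot
  refine ⟨F, hF0, fun s hs => ?_⟩
  have hu : IsUnit (MvPolynomial.eval s D) := by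
    rw [← hD]; exact isUnit_iff_ne_zero.2 hs
  -- Evaluation at a point with `δ s ≠ 0` extends to the localization and carries the relation to
  -- values.
  let ev : L →+* K := IsLocalization.Away.lift D hu
  have hev : ∀ a, ev (algebraMap _ L a) = MvPolynomial.eval s a :=
    fun a => IsLocalization.Away.lift_eq D hu a
  have hy : ∀ l, ev (y l) = h l s := by
    intro l
    have h1 : y l * algebraMap _ L (D ^ N l) = algebraMap _ L (p l) :=
      IsLocalization.mk'_spec L (p l) (⟨D ^ N l, N l, rfl⟩ : Submonoid.powers D)
    have h2 := congrArg ev h1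
    rw [map_mul, hev, hev, map_pow, ← hD, ← hp, ← hhq l s hs, mul_comm] at h2
    exact mul_left_cancel₀ (pow_ne_zero _ hs) h2
  have h3 := congrArg ev hF
  rw [map_zero, MvPolynomial.aeval_def, MvPolynomial.hom_eval₂] at h3
  have hc : ev.comp (algebraMap K L) = RingHom.id K := by
    ext c
    have : algebraMap K L c = algebraMap (MvPolynomial (Fin d) K) L (MvPolynomial.C c) := by
      rw [IsScalarTower.algebraMap_apply K (MvPolynomial (Fin d) K) L]; rfl
    simp only [RingHom.comp_apply, this, hev]
    simp
  rw [hc] at h3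
  simp only [hy] at h3
  exact h3

/-- A chain of `r + 1` primes yields `r` elements that are algebraically independent modulo the
smallest one. -/
theorem exists_independent_of_prime_chain {A : Type*} [CommRing A] [Algebra K A] :
    ∀ (r : ℕ) (p : Fin (r + 1) → Ideal A), StrictMono p → (∀ i, (p i).IsPrime) →
      ∃ h : Fin r → A, ∀ F : MvPolynomial (Fin r) K, MvPolynomial.aeval h F ∈ p 0 → F = 0 := by
  intro r
  induction r with
  | zero =>
    intro p _ hp
    refine ⟨Fin.elim0, fun F hF => ?_⟩
    by_contra hF0
    rw [MvPolynomial.eq_C_of_isEmpty F] at hF hF0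
    rw [MvPolynomial.aeval_C] at hF
    have hc : MvPolynomial.coeff 0 F ≠ 0 := fun h => hF0 (by rw [h, MvPolynomial.C_0])
    have hu : IsUnit (algebraMap K A (MvPolynomial.coeff 0 F)) :=
      (isUnit_iff_ne_zero.2 hc).map _
    exact (hp 0).ne_top (Ideal.eq_top_of_isUnit_mem _ hF hu)
  | succ r ih =>
    intro p hmono hp
    obtain ⟨h, hh⟩ := ih (fun i => p i.succ) (fun i j hij => hmono (Fin.succ_lt_succ_iff.2 hij))
      (fun i => hp _)
    -- The new element `f` is taken in `p 1` but outside `p 0`; the old ones are independent modulo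
    -- `p 1`.
    have h01 : p 0 < p 1 := hmono (by simp)
    obtain ⟨f, hf1, hf0⟩ := SetLike.exists_of_lt h01
    refine ⟨Fin.cons f h, fun F hF => ?_⟩
    by_contra hF0
    have key : ∀ G : MvPolynomial (Fin (r + 1)) K,
        MvPolynomial.aeval (Fin.cons f h : Fin (r + 1) → A) G =
          Polynomial.eval₂ (MvPolynomial.aeval h : MvPolynomial (Fin r) K →ₐ[K] A).toRingHom f
            (MvPolynomial.finSuccEquiv K r G) := by
      intro G
      induction G using MvPolynomial.induction_on with
      | C a => simp [MvPolynomial.finSuccEquiv_apply]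
      | add p q hp hq => simp [hp, hq, Polynomial.eval₂_add]
      | mul_X p i hp =>
        rw [map_mul, map_mul, Polynomial.eval₂_mul, hp, MvPolynomial.aeval_X]
        congr 1
        refine Fin.cases ?_ (fun j => ?_) i
        · simp [MvPolynomial.finSuccEquiv_X_zero]
        · simp [MvPolynomial.finSuccEquiv_X_succ]
    have hG0 : MvPolynomial.finSuccEquiv K r F ≠ 0 := by simpa using hF0
    -- A relation modulo `p 0` may be divided by powers of `f`, because `f ∉ p 0` and `p 0` is
    -- prime. Modulo `p 1`, where `f` is zero, only the constant term of `G` survives, a nontrivial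
    -- relation among the old elements.
    obtain ⟨m, G, hG, hGc⟩ : ∃ m, ∃ G : Polynomial (MvPolynomial (Fin r) K),
        MvPolynomial.finSuccEquiv K r F = Polynomial.X ^ m * G ∧ G.coeff 0 ≠ 0 := by
      obtain ⟨G, hG, hGd⟩ := Polynomial.exists_eq_pow_rootMultiplicity_mul_and_not_dvd _ hG0 0
      rw [map_zero, sub_zero] at hG hGd
      exact ⟨_, G, hG, fun h => hGd (Polynomial.X_dvd_iff.2 h)⟩
    rw [key, hG, Polynomial.eval₂_mul, Polynomial.eval₂_pow, Polynomial.eval₂_X] at hF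
    have hGp : Polynomial.eval₂ (MvPolynomial.aeval h : MvPolynomial (Fin r) K →ₐ[K] A).toRingHom
        f G ∈ p 1 :=
      h01.le (((hp 0).mem_or_mem hF).resolve_left fun h' => hf0 ((hp 0).mem_of_pow_mem _ h'))
    have hdiv := Polynomial.X_mul_divX_add G
    rw [← hdiv, Polynomial.eval₂_add, Polynomial.eval₂_mul, Polynomial.eval₂_X,
      Polynomial.eval₂_C] at hGp
    have := (Ideal.add_mem_iff_right (p 1) (Ideal.mul_mem_right _ _ hf1)).1 hGp
    exact hGc (hh _ this)

end Dependence

/-! ### The action of matrices on frames. -/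

section FrameAction

variable {K V : Type*} [Field K] [AddCommGroup V] [Module K V] {k : ℕ}

/-- The action of matrices on tuples of vectors. -/
def frameAct (c : Matrix (Fin k) (Fin k) K) : (Fin k → V) →ₗ[K] (Fin k → V) where
  toFun v i := ∑ j, c i j • v j
  map_add' v w := by ext i; simp [Finset.sum_add_distrib]
  map_smul' a v := by
    ext i
    simp only [Pi.smul_apply, RingHom.id_apply, Finset.smul_sum]
    exact Finset.sum_congr rfl fun j _ => smul_comm _ _ _

theorem frameAct_apply (c : Matrix (Fin k) (Fin k) K) (v : Fin k → V) (i : Fin k) :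
    frameAct c v i = ∑ j, c i j • v j := rfl

theorem frameAct_mul (c c' : Matrix (Fin k) (Fin k) K) (v : Fin k → V) :
    frameAct (c * c') v = frameAct c (frameAct c' v) := by
  ext i
  simp only [frameAct_apply, Matrix.mul_apply, Finset.sum_smul, Finset.smul_sum, smul_smul]
  exact Finset.sum_comm

theorem frameAct_one (v : Fin k → V) : frameAct (1 : Matrix (Fin k) (Fin k) K) v = v := by
  ext i
  simp [frameAct_apply, Matrix.one_apply]

theorem span_frameAct_le (c : Matrix (Fin k) (Fin k) K) (v : Fin k → V) :
    Submodule.span K (Set.range (frameAct c v)) ≤ Submodule.span K (Set.range v) := by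
  refine Submodule.span_le.2 ?_
  rintro _ ⟨i, rfl⟩
  change ∑ j, c i j • v j ∈ Submodule.span K (Set.range v)
  exact Submodule.sum_mem _ fun j _ =>
    Submodule.smul_mem _ _ (Submodule.subset_span (Set.mem_range_self j))

theorem span_frameAct {c : Matrix (Fin k) (Fin k) K} (hc : IsUnit c) (v : Fin k → V) :
    Submodule.span K (Set.range (frameAct c v)) = Submodule.span K (Set.range v) := by
  refine le_antisymm (span_frameAct_le c v) ?_
  obtain ⟨u, rfl⟩ := hc
  have h := span_frameAct_le (u⁻¹ : (Matrix (Fin k) (Fin k) K)ˣ).1 (frameAct u.1 v)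
  rwa [← frameAct_mul, Units.inv_mul, frameAct_one] at h

theorem linearIndependent_of_span_eq {v w : Fin k → V} (hv : LinearIndependent K v)
    (h : Submodule.span K (Set.range w) = Submodule.span K (Set.range v)) :
    LinearIndependent K w := by
  rw [linearIndependent_iff_card_eq_finrank_span] at hv ⊢
  rw [hv, Set.finrank, Set.finrank, h]

theorem exists_frameAct_eq {v w : Fin k → V}
    (h : Submodule.span K (Set.range w) ≤ Submodule.span K (Set.range v)) :
    ∃ c : Matrix (Fin k) (Fin k) K, frameAct c v = w := by
  have : ∀ i, ∃ a : Fin k → K, ∑ j, a j • v j = w i := fun i =>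
    (Submodule.mem_span_range_iff_exists_fun K).1
      (h (Submodule.subset_span (Set.mem_range_self i)))
  choose a ha using this
  exact ⟨Matrix.of a, funext ha⟩

theorem exists_isUnit_frameAct_eq {v w : Fin k → V} (hv : LinearIndependent K v)
    (h : Submodule.span K (Set.range w) = Submodule.span K (Set.range v)) :
    ∃ c : Matrix (Fin k) (Fin k) K, IsUnit c ∧ frameAct c v = w := by
  obtain ⟨c, hc⟩ := exists_frameAct_eq h.le
  obtain ⟨c', hc'⟩ := exists_frameAct_eq h.ge
  refine ⟨c, IsUnit.of_mul_eq_one_right c' ?_, hc⟩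
  have h1 : frameAct (c' * c) v = v := by rw [frameAct_mul, hc, hc']
  ext i j
  have h2 := congrFun h1 i
  rw [frameAct_apply] at h2
  have h3 : ∑ l, ((c' * c) i l - (1 : Matrix (Fin k) (Fin k) K) i l) • v l = 0 := by
    simp only [sub_smul, Finset.sum_sub_distrib, h2]
    simp [Matrix.one_apply]
  exact sub_eq_zero.1 (Fintype.linearIndependent_iff.1 hv _ h3 j)

end FrameAction

/-! ### Affine charts of the Grassmannian. -/

section Chart

variable {K V : Type*} [Field K] [AddCommGroup V] [Module K V] {k : ℕ}
  (ψ : V →ₗ[K] (Fin k → K))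

/-- The matrix of coordinates of a tuple of vectors. -/
def chartMatrix (v : Fin k → V) : Matrix (Fin k) (Fin k) K := Matrix.of fun i => ψ (v i)

/-- The frame of the span of `v` on which `ψ` takes the standard values. -/
noncomputable def chartFrame (v : Fin k → V) : Fin k → V := frameAct (chartMatrix ψ v)⁻¹ v

theorem chartMatrix_apply_mem (i j : Fin k) :
    (fun v : Fin k → V => chartMatrix ψ v i j) ∈ polyFun K (Fin k → V) :=
  dual_mem_polyFun ((LinearMap.proj (φ := fun _ : Fin k => K) j).comp
    (ψ.comp (LinearMap.proj (φ := fun _ : Fin k => V) i)))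

/-- The matrix of coordinates with polynomial functions as entries. -/
def chartPolyMatrix : Matrix (Fin k) (Fin k) (polyFun K (Fin k → V)) :=
  Matrix.of fun i j => ⟨_, chartMatrix_apply_mem ψ i j⟩

/-- Evaluation of polynomial functions. -/
def polyFunEval {W : Type*} [AddCommGroup W] [Module K W] (w : W) : polyFun K W →+* K :=
  (Pi.evalRingHom (fun _ : W => K) w).comp (polyFun K W).toSubring.subtype

theorem polyFunEval_apply {W : Type*} [AddCommGroup W] [Module K W] (w : W) (f : polyFun K W) :
    polyFunEval w f = f.1 w := rfl

theorem map_chartPolyMatrix (v : Fin k → V) :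
    (polyFunEval v).mapMatrix (chartPolyMatrix ψ) = chartMatrix ψ v := rfl

/-- The determinant is formed over the ring of polynomial functions; evaluation at `v` is a ring
homomorphism and commutes with it. -/
theorem det_chartMatrix_mem :
    (fun v : Fin k → V => (chartMatrix ψ v).det) ∈ polyFun K (Fin k → V) := by
  convert (chartPolyMatrix ψ).det.2 using 1
  ext v
  rw [← map_chartPolyMatrix, ← RingHom.map_det, polyFunEval_apply]

theorem adjugate_chartMatrix_mem (i j : Fin k) :
    (fun v : Fin k → V => (chartMatrix ψ v).adjugate i j) ∈ polyFun K (Fin k → V) := by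
  convert ((chartPolyMatrix ψ).adjugate i j).2 using 1
  ext v
  rw [← map_chartPolyMatrix, ← RingHom.map_adjugate]
  rfl

/-- Cramer's rule: the inverse matrix is the adjugate over the determinant, so linear functionals
need one power of the determinant and polynomials in them need some power. -/
theorem isRegularOff_chartFrame {f : (Fin k → V) → K} (hf : f ∈ polyFun K (Fin k → V)) :
    IsRegularOff (fun v : Fin k → V => (chartMatrix ψ v).det) (fun v => f (chartFrame ψ v)) := by
  refine IsRegularOff.comp_of_mem (det_chartMatrix_mem ψ) (fun φ => ?_) hf
  refine ⟨1, fun v => φ (fun i => ∑ j, (chartMatrix ψ v).adjugate i j • v j), ?_, ?_⟩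
  · refine (IsPolyMap.pi fun i => IsPolyMap.sum _ fun j _ => ?_) φ
    exact (isPolyMap_linear (LinearMap.proj (R := K) (φ := fun _ : Fin k => V) j)).smul (adjugate_chartMatrix_mem ψ i j)
  · intro v hv
    simp only
    rw [pow_one, ← smul_eq_mul, ← map_smul]
    congr 1
    ext i
    rw [Pi.smul_apply, chartFrame, frameAct_apply, Finset.smul_sum]
    refine Finset.sum_congr rfl fun j _ => ?_
    rw [smul_smul, Matrix.inv_def, Matrix.smul_apply, smul_eq_mul, Ring.inverse_eq_inv',
      mul_inv_cancel_left₀ hv]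

variable {ψ}

theorem isUnit_chartMatrix {v : Fin k → V} (hv : (chartMatrix ψ v).det ≠ 0) :
    IsUnit (chartMatrix ψ v) :=
  (Matrix.isUnit_iff_isUnit_det _).2 (isUnit_iff_ne_zero.2 hv)

theorem span_chartFrame {v : Fin k → V} (hv : (chartMatrix ψ v).det ≠ 0) :
    Submodule.span K (Set.range (chartFrame ψ v)) = Submodule.span K (Set.range v) :=
  span_frameAct ((Matrix.isUnit_nonsing_inv_iff).2 (isUnit_chartMatrix hv)) v

theorem chart_chartFrame {v : Fin k → V} (hv : (chartMatrix ψ v).det ≠ 0) (i : Fin k) :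
    ψ (chartFrame ψ v i) = Pi.single i 1 := by
  rw [chartFrame, frameAct_apply, map_sum]
  ext l
  have h := congrFun (congrFun (Matrix.nonsing_inv_mul (chartMatrix ψ v)
    (isUnit_iff_ne_zero.2 hv)) i) l
  rw [Matrix.mul_apply] at h
  simp only [map_smul, Finset.sum_apply, Pi.smul_apply, smul_eq_mul]
  rw [Pi.single_apply]
  simpa [Matrix.one_apply, eq_comm, chartMatrix] using h

theorem linearIndependent_of_det_ne_zero {v : Fin k → V} (hv : (chartMatrix ψ v).det ≠ 0) :
    LinearIndependent K v := by
  have h : LinearIndependent K (chartMatrix ψ v).row :=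
    Matrix.linearIndependent_rows_iff_isUnit.2 (isUnit_chartMatrix hv)
  exact LinearIndependent.of_comp ψ h

theorem det_ne_zero_of_span_eq {v w : Fin k → V} (hv : (chartMatrix ψ v).det ≠ 0)
    (h : Submodule.span K (Set.range w) = Submodule.span K (Set.range v)) :
    (chartMatrix ψ w).det ≠ 0 := by
  obtain ⟨c, hc, rfl⟩ := exists_isUnit_frameAct_eq (linearIndependent_of_det_ne_zero hv) h
  have : chartMatrix ψ (frameAct c v) = c * chartMatrix ψ v := by
    ext i j
    simp [chartMatrix, frameAct_apply, Matrix.mul_apply]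
  rw [this, Matrix.det_mul]
  exact mul_ne_zero ((Matrix.isUnit_iff_isUnit_det _).1 hc).ne_zero hv

/-- The transition matrix is read off by `ψ` and is the identity. Hence the normalised frame depends
only on the subspace, and polynomials in it are functions on the chart. -/
theorem frame_eq_of_span_eq {v w : Fin k → V}
    (h : Submodule.span K (Set.range w) = Submodule.span K (Set.range v))
    (hψv : ∀ i, ψ (v i) = Pi.single i 1) (hψw : ∀ i, ψ (w i) = Pi.single i 1) : w = v := by
  obtain ⟨c, rfl⟩ := exists_frameAct_eq h.le
  have hc : c = 1 := by
    ext i j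
    have h1 := congrFun (hψw i) j
    simp only [frameAct_apply, map_sum, map_smul, hψv, Finset.sum_apply, Pi.smul_apply,
      Pi.single_apply, smul_eq_mul, mul_ite, mul_one, mul_zero] at h1
    simpa [Matrix.one_apply, eq_comm] using h1
  rw [hc, frameAct_one]

theorem chartMatrix_eq_one {v : Fin k → V} (hψv : ∀ i, ψ (v i) = Pi.single i 1) :
    chartMatrix ψ v = 1 := by
  ext i j
  simp [chartMatrix, hψv, Pi.single_apply, Matrix.one_apply, eq_comm]

theorem chartFrame_eq_of_span_eq {v w : Fin k → V} (hv : (chartMatrix ψ v).det ≠ 0)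
    (h : Submodule.span K (Set.range w) = Submodule.span K (Set.range v)) :
    chartFrame ψ w = chartFrame ψ v := by
  have hw := det_ne_zero_of_span_eq hv h
  exact frame_eq_of_span_eq (by rw [span_chartFrame hv, span_chartFrame hw, h])
    (chart_chartFrame hv) (chart_chartFrame hw)

theorem exists_chart {v : Fin k → V} (hv : LinearIndependent K v) :
    ∃ ψ : V →ₗ[K] (Fin k → K), (chartMatrix ψ v).det ≠ 0 := by
  obtain ⟨ψ, hψ⟩ := LinearMap.exists_leftInverse_of_injective (Fintype.linearCombination K v)
    (LinearMap.ker_eq_bot.2 hv.fintypeLinearCombination_injective)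
  refine ⟨ψ, ?_⟩
  rw [chartMatrix_eq_one, Matrix.det_one]
  · exact one_ne_zero
  · intro i
    have := LinearMap.congr_fun hψ (Pi.single i 1)
    simpa [Fintype.linearCombination_apply_single] using this

end Chart

/-! ### Zariski-closed sets of bi-Lagrangian subspaces. -/

namespace SkewPencil

variable {K V : Type*} [Field K] [AddCommGroup V] [Module K V] (P : SkewPencil K V)

/-- The dimension of the bi-Lagrangian subspaces. -/
noncomputable abbrev lagDim : ℕ := Module.finrank K V - P.rank / 2

/-- The set of those bi-Lagrangian subspaces all of whose frames satisfy the equations in `S`. -/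
def zeroSet (S : Set ((Fin P.lagDim → V) → K)) : Set P.BLG :=
  {L | ∀ v : Fin P.lagDim → V, LinearIndependent K v → Submodule.span K (Set.range v) = L.1 →
    ∀ f ∈ S, f v = 0}

variable {P}

theorem isClosed_zeroSet {S : Set ((Fin P.lagDim → V) → K)}
    (hS : S ⊆ (polyFun K (Fin P.lagDim → V) : Set ((Fin P.lagDim → V) → K))) : IsClosed (P.zeroSet S) := by
  refine isClosed_induced_iff.2 ⟨{M | ∀ v : Frames K V P.lagDim, v.span = M → ∀ f ∈ S, f v.1 = 0},
    ?_, ?_⟩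
  -- The frames of a given span form one orbit of invertible matrices, so a condition on all of them
  -- amounts to the transforms of each equation by every such matrix.
  · refine isClosed_coinduced.2 ((isClosed_induced_iff
      (t := zariskiTopology K (Fin P.lagDim → V))).2 ⟨{v | ∀ f ∈ {f | ∃ g ∈ S,
      ∃ c : Matrix (Fin P.lagDim) (Fin P.lagDim) K, IsUnit c ∧ f = fun v => g (frameAct c v)},
      f v = 0}, ?_, ?_⟩)
    · refine isClosed_zariskiTopology_iff.2 ⟨_, ?_, rfl⟩
      rintro _ ⟨g, hg, c, -, rfl⟩
      exact (isPolyMap_linear (frameAct c)).comp_mem (hS hg)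
    · ext v
      constructor
      · intro h w hw f hf
        have hw' := congrArg Subtype.val hw
        obtain ⟨c, hc, hcv⟩ := exists_isUnit_frameAct_eq v.2 hw'
        rw [← hcv]
        exact h _ ⟨f, hf, c, hc, rfl⟩
      · rintro h _ ⟨g, hg, c, hc, rfl⟩
        exact h ⟨frameAct c v.1, linearIndependent_of_span_eq v.2 (span_frameAct hc _)⟩
          (Subtype.ext (span_frameAct hc _)) g hg
  · ext L
    constructor
    · intro h v hv hvL f hf
      exact h ⟨v, hv⟩ (Subtype.ext hvL) f hf
    · intro h v hv f hf
      exact h v.1 v.2 (congrArg Subtype.val hv) f hf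

theorem exists_equations {C : Set P.BLG} (hC : IsClosed C) :
    ∃ S ⊆ (polyFun K (Fin P.lagDim → V) : Set ((Fin P.lagDim → V) → K)), ∀ L : P.BLG, ∀ v : Fin P.lagDim → V,
      LinearIndependent K v → Submodule.span K (Set.range v) = L.1 →
        (L ∈ C ↔ ∀ f ∈ S, f v = 0) := by
  obtain ⟨D, hD, rfl⟩ := isClosed_induced_iff.1 hC
  obtain ⟨E, hE, hED⟩ := (isClosed_induced_iff
    (t := zariskiTopology K (Fin P.lagDim → V))).1 (isClosed_coinduced.1 hD)
  obtain ⟨S, hS, rfl⟩ := isClosed_zariskiTopology_iff.1 hE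
  refine ⟨S, hS, fun L v hv hvL => ?_⟩
  have h : Frames.span (⟨v, hv⟩ : Frames K V P.lagDim) = BLG.toGr P L := Subtype.ext hvL
  have h' : ∀ w : Frames K V P.lagDim, Frames.span w ∈ D ↔ ∀ f ∈ S, f w.1 = 0 := fun w =>
    (Set.ext_iff.1 hED w).symm
  rw [← h' ⟨v, hv⟩, h]
  rfl

theorem exists_frame [FiniteDimensional K V] (L : P.BLG) : ∃ v : Fin P.lagDim → V,
    LinearIndependent K v ∧ Submodule.span K (Set.range v) = L.1 := by
  have hL : Module.finrank K L.1 = P.lagDim := (BLG.toGr P L).2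
  let b := Module.finBasisOfFinrankEq K L.1 hL
  refine ⟨fun i => b i, b.linearIndependent.map' L.1.subtype L.1.ker_subtype, ?_⟩
  have := congrArg (Submodule.map L.1.subtype) b.span_eq
  rw [Submodule.map_span, ← Set.range_comp, Submodule.map_top, Submodule.range_subtype] at this
  exact this

/-- The bi-Lagrangian subspaces in the domain of a chart on which the function `f` of the
normalised frame vanishes, and those outside of the domain. -/
theorem exists_chart_locus (ψ : V →ₗ[K] (Fin P.lagDim → K)) {f : (Fin P.lagDim → V) → K}
    (hf : f ∈ polyFun K (Fin P.lagDim → V)) : ∃ C : Set P.BLG, IsClosed C ∧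
      ∀ L : P.BLG, ∀ v : Fin P.lagDim → V, Submodule.span K (Set.range v) = L.1 →
        (chartMatrix ψ v).det ≠ 0 → (L ∈ C ↔ f (chartFrame ψ v) = 0) := by
  obtain ⟨N, q, hq, hfq⟩ := isRegularOff_chartFrame ψ hf
  refine ⟨P.zeroSet {fun v => (chartMatrix ψ v).det * q v}, isClosed_zeroSet ?_, ?_⟩
  · rintro _ rfl
    exact mul_mem (det_chartMatrix_mem ψ) hq
  · intro L v hvL hv
    constructor
    · intro h
      have h1 := h v (linearIndependent_of_det_ne_zero hv) hvL _ rfl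
      have h2 := (mul_eq_zero.1 h1).resolve_left hv
      rw [← hfq v hv] at h2
      exact (mul_eq_zero.1 h2).resolve_left (pow_ne_zero _ hv)
    · rintro h w hw hwL _ rfl
      have hwv := hwL.trans hvL.symm
      have hw0 := det_ne_zero_of_span_eq hv hwv
      have h1 := hfq w hw0
      simp only at h1 ⊢
      rw [← h1, chartFrame_eq_of_span_eq hv hwv, h, mul_zero, mul_zero]

theorem exists_chart_complement (ψ : V →ₗ[K] (Fin P.lagDim → K)) : ∃ C : Set P.BLG, IsClosed C ∧
      ∀ L : P.BLG, ∀ v : Fin P.lagDim → V, LinearIndependent K v →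
        Submodule.span K (Set.range v) = L.1 → (L ∈ C ↔ (chartMatrix ψ v).det = 0) := by
  refine ⟨P.zeroSet {fun v => (chartMatrix ψ v).det}, isClosed_zeroSet ?_, ?_⟩
  · rintro _ rfl
    exact det_chartMatrix_mem ψ
  · intro L v hv hvL
    constructor
    · intro h
      exact h v hv hvL _ rfl
    · rintro h w hw hwL _ rfl
      by_contra hw0
      exact det_ne_zero_of_span_eq hw0 (hvL.trans hwL.symm) h

end SkewPencil

/-! ### Upper bound for the Krull dimension from a parametrization. -/

/-- The subspaces in `S` are the spans of the values of finitely many polynomial maps defined on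
`K ^ d`. -/
def IsParametrized {K V : Type*} [Field K] [AddCommGroup V] [Module K V] (k d : ℕ)
    (S : Set (Submodule K V)) : Prop :=
  ∃ F : Set ((Fin d → K) → Fin k → V), F.Finite ∧ (∀ Φ ∈ F, IsPolyMap (K := K) Φ) ∧
    ∀ L ∈ S, ∃ Φ ∈ F, ∃ s, L = Submodule.span K (Set.range (Φ s))

namespace SkewPencil

variable {K V : Type*} [Field K] [AddCommGroup V] [Module K V] {P : SkewPencil K V}

/-- The ideal of the polynomial functions of the normalised frame that vanish on `Z`. -/
def chartIdeal (ψ : V →ₗ[K] (Fin P.lagDim → K)) (Z : Set P.BLG) :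
    Ideal (polyFun K (Fin P.lagDim → V)) where
  carrier := {f | ∀ L ∈ Z, ∀ v : Fin P.lagDim → V, Submodule.span K (Set.range v) = L.1 →
    (chartMatrix ψ v).det ≠ 0 → f.1 (chartFrame ψ v) = 0}
  zero_mem' _ _ _ _ _ := rfl
  add_mem' {f g} hf hg L hL v hv hv0 := by
    have h1 := hf L hL v hv hv0
    have h2 := hg L hL v hv hv0
    change f.1 _ + g.1 _ = 0
    rw [h1, h2, add_zero]
  smul_mem' c f hf L hL v hv hv0 := by
    have h1 := hf L hL v hv hv0
    change c.1 _ * f.1 _ = 0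
    rw [h1, mul_zero]

/-- If a product vanishes on `Z` in the chart, then `Z` is covered by the complement of the chart
and the zero loci of the two factors. Irreducibility selects one of the three, and `L₀` rules out
the complement. -/
theorem chartIdeal_isPrime [FiniteDimensional K V] {ψ : V →ₗ[K] (Fin P.lagDim → K)} {Z : Set P.BLG}
    (hZ : IsIrreducible Z) {L₀ : P.BLG} (hL₀ : L₀ ∈ Z) {v₀ : Fin P.lagDim → V}
    (hv₀ : Submodule.span K (Set.range v₀) = L₀.1) (hψ : (chartMatrix ψ v₀).det ≠ 0) :
    (chartIdeal ψ Z).IsPrime := by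
  refine ⟨fun h => ?_, fun {f g} hfg => ?_⟩
  · have h1 : (1 : polyFun K (Fin P.lagDim → V)) ∈ chartIdeal ψ Z := h ▸ Submodule.mem_top
    exact one_ne_zero (h1 L₀ hL₀ v₀ hv₀ hψ)
  · obtain ⟨C, hC, hCf⟩ := exists_chart_locus (P := P) ψ f.2
    obtain ⟨D, hD, hDg⟩ := exists_chart_locus (P := P) ψ g.2
    obtain ⟨E, hE, hEψ⟩ := exists_chart_complement (P := P) ψ
    have hsub : Z ⊆ (E ∪ C) ∪ D := by
      intro L hL
      by_contra hLC
      simp only [Set.mem_union, not_or] at hLC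
      obtain ⟨v, hv, hvL⟩ := exists_frame L
      have hv0 : (chartMatrix ψ v).det ≠ 0 := fun h => hLC.1.1 ((hEψ L v hv hvL).2 h)
      rcases mul_eq_zero.1 (hfg L hL v hvL hv0) with h | h
      · exact hLC.1.2 ((hCf L v hvL hv0).2 h)
      · exact hLC.2 ((hDg L v hvL hv0).2 h)
    have hZE : ¬ Z ⊆ E := fun h => hψ
      ((hEψ L₀ v₀ (linearIndependent_of_det_ne_zero hψ) hv₀).1 (h hL₀))
    have hirr := isPreirreducible_iff_isClosed_union_isClosed.1 hZ.2
    rcases hirr _ _ (hE.union hC) hD hsub with h | h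
    · rcases hirr _ _ hE hC h with h | h
      · exact absurd h hZE
      · exact Or.inl fun L hL v hvL hv0 => (hCf L v hvL hv0).1 (h hL)
    · exact Or.inr fun L hL v hvL hv0 => (hDg L v hvL hv0).1 (h hL)

theorem chartIdeal_anti (ψ : V →ₗ[K] (Fin P.lagDim → K)) {Z Z' : Set P.BLG} (h : Z ⊆ Z') :
    chartIdeal ψ Z' ≤ chartIdeal ψ Z := fun _ hf L hL => hf L (h hL)

/-- Equations of `Z`, evaluated on normalised frames, belong to its chart ideal, so they vanish on
the part of `Z'` in the chart; irreducibility of `Z'` discards the rest. Strict inclusions of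
irreducible closed sets meeting the chart thus give strict inclusions of ideals. -/
theorem subset_of_chartIdeal_le [FiniteDimensional K V] {ψ : V →ₗ[K] (Fin P.lagDim → K)}
    {Z Z' : Set P.BLG} (hZ : IsClosed Z) (hZ' : IsIrreducible Z') {L₀ : P.BLG} (hL₀ : L₀ ∈ Z')
    {v₀ : Fin P.lagDim → V} (hv₀ : Submodule.span K (Set.range v₀) = L₀.1)
    (hψ : (chartMatrix ψ v₀).det ≠ 0) (h : chartIdeal ψ Z ≤ chartIdeal ψ Z') : Z' ⊆ Z := by
  obtain ⟨E, hE, hEψ⟩ := exists_chart_complement (P := P) ψ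
  obtain ⟨S, hS, hSZ⟩ := exists_equations hZ
  have hsub : Z' ⊆ E ∪ Z := by
    intro L hL
    by_contra hLE
    simp only [Set.mem_union, not_or] at hLE
    obtain ⟨v, hv, hvL⟩ := exists_frame L
    have hv0 : (chartMatrix ψ v).det ≠ 0 := fun h => hLE.1 ((hEψ L v hv hvL).2 h)
    have hframe : ∀ (L : P.BLG) (v : Fin P.lagDim → V), Submodule.span K (Set.range v) = L.1 →
        (chartMatrix ψ v).det ≠ 0 → (L ∈ Z ↔ ∀ f ∈ S, f (chartFrame ψ v) = 0) :=
      fun L v hvL hv0 => hSZ L _ (linearIndependent_of_span_eq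
        (linearIndependent_of_det_ne_zero hv0) (span_chartFrame hv0))
        ((span_chartFrame hv0).trans hvL)
    refine hLE.2 ((hframe L v hvL hv0).2 fun f hf => ?_)
    refine h (x := ⟨f, hS hf⟩) (fun L' hL' v' hvL' hv0' => ?_) L hL v hvL hv0
    exact (hframe L' v' hvL' hv0').1 hL' f hf
  rcases isPreirreducible_iff_isClosed_union_isClosed.1 hZ'.2 _ _ hE hZ hsub with h | h
  · exact absurd ((hEψ L₀ v₀ (linearIndependent_of_det_ne_zero hψ) hv₀).1 (h hL₀)) hψ
  · exact h

theorem krullDim_le_of_isParametrized [Infinite K] [FiniteDimensional K V] {d : ℕ}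
    (h : IsParametrized P.lagDim d {L | P.IsBiLagrangian L}) :
    topologicalKrullDim P.BLG ≤ d := by
  refine iSup_le fun p => ?_
  by_contra hlen
  have hlen : d + 1 ≤ p.length := by
    by_contra h'
    exact hlen (by exact_mod_cast (by omega : p.length ≤ d))
  -- A point of the smallest set lies in all of them, so one chart around it serves the whole chain.
  obtain ⟨L₀, hL₀⟩ := (p 0).isIrreducible'.1
  obtain ⟨v₀, hv₀, hvL₀⟩ := exists_frame L₀
  obtain ⟨ψ, hψ⟩ := exists_chart hv₀
  have hmem : ∀ i, L₀ ∈ (p i).carrier := fun i => p.monotone (Fin.zero_le i) hL₀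
  -- Larger sets have smaller ideals, hence the reversal; the prime of index `0` belongs to the
  -- largest set.
  obtain ⟨g, hg⟩ := exists_independent_of_prime_chain (K := K) p.length
    (fun i => chartIdeal ψ (p i.rev).carrier)
    (fun i j hij => by
      have hlt := p.strictMono (Fin.rev_lt_rev.2 hij)
      refine lt_of_le_not_ge (chartIdeal_anti ψ hlt.le) fun hle => ?_
      exact hlt.not_ge (subset_of_chartIdeal_le (p j.rev).isClosed' (p i.rev).isIrreducible'
        (hmem _) hvL₀ hψ hle))
    (fun i => chartIdeal_isPrime (p i.rev).isIrreducible' (hmem _) hvL₀ hψ)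
  obtain ⟨F, hFfin, hFpoly, hFcov⟩ := h
  let e : Fin (d + 1) → Fin p.length := Fin.castLE hlen
  have hrel : ∀ Φ : F, ∃ R : MvPolynomial (Fin (d + 1)) K, R ≠ 0 ∧ ∀ s : Fin d → K,
      (chartMatrix ψ (Φ.1 s)).det ≠ 0 →
        MvPolynomial.eval (fun l => (g (e l)).1 (chartFrame ψ (Φ.1 s))) R = 0 := by
    intro Φ
    refine exists_relation_of_fractions
      (δ := fun s => (chartMatrix ψ (Φ.1 s)).det)
      (h := fun l s => (g (e l)).1 (chartFrame ψ (Φ.1 s)))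
      ((hFpoly Φ.1 Φ.2).comp_mem (det_chartMatrix_mem ψ)) fun l => ?_
    obtain ⟨N, q, hq, hgq⟩ := isRegularOff_chartFrame ψ (g (e l)).2
    exact ⟨N, _, (hFpoly Φ.1 Φ.2).comp_mem hq, fun s hs => hgq _ hs⟩
  choose R hR0 hR using hrel
  have := hFfin.fintype
  have hprod : (∏ Φ : F, R Φ) ≠ 0 := Finset.prod_ne_zero_iff.2 fun Φ _ => hR0 Φ
  have hinj : Function.Injective e := Fin.castLE_injective hlen
  -- Each subspace lies in the image of some `Φ`, so the product of the finitely many relations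
  -- vanishes on the whole chart; independence then forces this product to be zero.
  refine hprod (MvPolynomial.rename_injective e hinj ((hg _ ?_).trans (map_zero _).symm))
  intro L _ v hvL hv0
  obtain ⟨Φ, hΦ, s, hs⟩ := hFcov L.1 L.2
  have heval : ∀ G : MvPolynomial (Fin p.length) K,
      (MvPolynomial.aeval g G).1 (chartFrame ψ v) =
        MvPolynomial.eval (fun l => (g l).1 (chartFrame ψ v)) G := by
    intro G
    induction G using MvPolynomial.induction_on with
    | C a => simp
    | add p q hp hq => rw [map_add, map_add, ← hp, ← hq]; rfl
    | mul_X p i hp => rw [map_mul, map_mul, ← hp, MvPolynomial.aeval_X, MvPolynomial.eval_X]; rfl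
  rw [heval, MvPolynomial.eval_rename, map_prod]
  refine Finset.prod_eq_zero (Finset.mem_univ ⟨Φ, hΦ⟩) ?_
  have hspan : Submodule.span K (Set.range (Φ s)) = Submodule.span K (Set.range v) := by
    rw [← hs, hvL]
  have := hR ⟨Φ, hΦ⟩ s (det_ne_zero_of_span_eq hv0 hspan)
  rw [chartFrame_eq_of_span_eq hv0 hspan] at this
  exact this

/-! ### Lower bound for the Krull dimension from a polynomial family. -/

/-- Truncation of a vector at the coordinate `m`. -/
def truncate (d m : ℕ) : (Fin d → K) →ₗ[K] (Fin d → K) where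
  toFun t i := if (i : ℕ) < m then t i else 0
  map_add' s t := by ext i; simp only [Pi.add_apply]; split_ifs <;> simp
  map_smul' c t := by ext i; simp

/-- The closures of the images of the coordinate subspaces `K ^ m`, `m ≤ d`, form the chain.
Normalisation by `ψ` makes `Φ t` the chart frame, so the functionals `ℓ` turn the parameters into
regular functions on the chart. -/
theorem le_krullDim_of_polynomial_family [Infinite K] {d : ℕ}
    {Φ : (Fin d → K) → Fin P.lagDim → V} (hΦ : IsPolyMap (K := K) Φ)
    (hlag : ∀ t, P.IsBiLagrangian (Submodule.span K (Set.range (Φ t))))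
    (ψ : V →ₗ[K] (Fin P.lagDim → K)) (hψ : ∀ t i, ψ (Φ t i) = Pi.single i 1)
    (ℓ : Fin d → Module.Dual K (Fin P.lagDim → V)) (hℓ : ∀ m t, ℓ m (Φ t) = t m) :
    (d : WithBot ℕ∞) ≤ topologicalKrullDim P.BLG := by
  let j : (Fin d → K) → P.BLG := fun t => ⟨_, hlag t⟩
  have hdet : ∀ t, (chartMatrix ψ (Φ t)).det ≠ 0 := fun t => by
    rw [chartMatrix_eq_one (hψ t), Matrix.det_one]; exact one_ne_zero
  have hframe : ∀ t, chartFrame ψ (Φ t) = Φ t := fun t =>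
    frame_eq_of_span_eq (span_chartFrame (hdet t)) (hψ t) (chart_chartFrame (hdet t))
  let T : ℕ → Set P.BLG := fun m => Set.range fun t => j (truncate d m t)
  have hirr : ∀ m, IsIrreducible (T m) := by
    intro m
    refine ⟨Set.range_nonempty _, isPreirreducible_iff_isClosed_union_isClosed.2 ?_⟩
    intro C D hC hD hCD
    obtain ⟨S, hS, hSC⟩ := exists_equations hC
    obtain ⟨S', hS', hSD⟩ := exists_equations hD
    by_contra hnot
    simp only [not_or, Set.not_subset] at hnot
    obtain ⟨⟨_, ⟨t, rfl⟩, ht⟩, ⟨_, ⟨t', rfl⟩, ht'⟩⟩ := hnot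
    have hli := fun t => linearIndependent_of_det_ne_zero (hdet t)
    rw [hSC _ _ (hli _) rfl] at ht
    rw [hSD _ _ (hli _) rfl] at ht'
    push Not at ht ht'
    obtain ⟨f, hf, hft⟩ := ht
    obtain ⟨f', hf', hft'⟩ := ht'
    have hpoly : IsPolyMap (K := K) fun t => Φ (truncate d m t) := hΦ.comp (isPolyMap_linear _)
    rcases eq_zero_or_eq_zero_of_mul_polyFun (hpoly.comp_mem (hS hf)) (hpoly.comp_mem (hS' hf'))
      (fun s => by
        rcases hCD ⟨s, rfl⟩ with h | h
        · exact Or.inl ((hSC _ _ (hli _) rfl).1 h f hf)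
        · exact Or.inr ((hSD _ _ (hli _) rfl).1 h f' hf')) with h | h
    · exact hft (congrFun h t)
    · exact hft' (congrFun h t')
  have hmono : ∀ m, closure (T m) ⊆ closure (T (m + 1)) := by
    intro m
    refine closure_mono ?_
    rintro _ ⟨t, rfl⟩
    refine ⟨truncate d m t, ?_⟩
    simp only
    congr 1
    ext i
    simp only [truncate, LinearMap.coe_mk, AddHom.coe_mk]
    split_ifs <;> first | rfl | omega
  let Z : Fin (d + 1) → TopologicalSpace.IrreducibleCloseds P.BLG := fun m =>
    ⟨closure (T m), (hirr m).closure, isClosed_closure⟩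
  have hZ : StrictMono Z := by
    refine Fin.strictMono_iff_lt_succ.2 fun m => lt_of_le_not_ge (hmono m) fun hle => ?_
    -- The coordinate `t m` vanishes on `T m` and equals `1` at one point of `T (m + 1)`.
    obtain ⟨C, hC, hCℓ⟩ := exists_chart_locus (P := P) ψ (dual_mem_polyFun (ℓ m))
    have h1 : closure (T m) ⊆ C := by
      refine closure_minimal ?_ hC
      rintro _ ⟨t, rfl⟩
      rw [hCℓ _ (Φ (truncate d m t)) rfl (hdet _), hframe, hℓ]
      simp [truncate]
    have h2 : j (truncate d (m + 1) (Pi.single m 1)) ∈ C :=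
      h1 (hle (subset_closure ⟨Pi.single m 1, rfl⟩))
    rw [hCℓ _ (Φ _) rfl (hdet _), hframe, hℓ] at h2
    simp [truncate] at h2
  exact Order.LTSeries.length_le_krullDim (LTSeries.mk d Z hZ)

end SkewPencil

/-! ### Sums with the span of a family that has dual functionals. -/

section DualFamily

variable {K V : Type*} [Field K] [AddCommGroup V] [Module K V] {κ : Type*} [Fintype κ]
  [DecidableEq κ] {Z : Submodule K V} {g : κ → V} {φ : κ → Module.Dual K V}

theorem mem_of_mem_sup_span_of_dual (hg : ∀ p q, φ q (g p) = if p = q then 1 else 0)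
    (hZ : ∀ q, ∀ z ∈ Z, φ q z = 0) {u : V} (hu : u ∈ Z ⊔ Submodule.span K (Set.range g))
    (h : ∀ q, φ q u = 0) : u ∈ Z := by
  obtain ⟨z, hz, w, hw, rfl⟩ := Submodule.mem_sup.1 hu
  obtain ⟨c, rfl⟩ := (Submodule.mem_span_range_iff_exists_fun K).1 hw
  have hc : ∀ q, c q = 0 := fun q => by
    have := h q
    rw [map_add, hZ q z hz, map_sum, zero_add] at this
    simpa [hg] using this
  simpa [hc] using hz

theorem finrank_sup_span_of_dual [FiniteDimensional K V]
    (hg : ∀ p q, φ q (g p) = if p = q then 1 else 0) (hZ : ∀ q, ∀ z ∈ Z, φ q z = 0) :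
    Module.finrank K ↥(Z ⊔ Submodule.span K (Set.range g)) =
      Module.finrank K Z + Fintype.card κ := by
  have hli : LinearIndependent K g := by
    rw [Fintype.linearIndependent_iff]
    intro c hc q
    have := congrArg (φ q) hc
    rw [map_sum] at this
    simpa [hg] using this
  have hinf : Z ⊓ Submodule.span K (Set.range g) = ⊥ := by
    rw [eq_bot_iff]
    rintro u ⟨hu, hu'⟩
    refine mem_of_mem_sup_span_of_dual (Z := ⊥) hg (fun q z hz => ?_)
      (Submodule.mem_sup_right hu') fun q => hZ q u hu
    rw [(Submodule.mem_bot K).1 hz, map_zero]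
  have := Submodule.finrank_sup_add_finrank_inf_eq Z (Submodule.span K (Set.range g))
  rw [hinf, finrank_bot, finrank_span_eq_card hli] at this
  simpa using this

end DualFamily

theorem sum_eq_sum_update_add_one {ι : Type*} [Fintype ι] [DecidableEq ι] {n : ι → ℕ}
    {j : ι} (hj : 0 < n j) :
    ∑ i, n i = ∑ i, Function.update n j (n j - 1) i + 1 := by
  rw [Finset.sum_update_of_mem (Finset.mem_univ j),
    ← Finset.add_sum_erase _ _ (Finset.mem_univ j), Finset.sdiff_singleton_eq_erase]
  omega

/-! ### Jordan frames of subquotients, and their changes. -/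

section JordanFrame

variable {K V : Type*} [Field K] [AddCommGroup V] [Module K V]

/-- A symplectic form together with a self-adjoint endomorphism. -/
structure IsSelfAdjointPair (ω : LinearMap.BilinForm K V) (x : Module.End K V) : Prop where
  alt : ω.IsAlt
  nondegenerate : ω.Nondegenerate
  selfAdjoint : ∀ u v, ω (x u) v = ω u (x v)

/-- An invariant Lagrangian subspace. -/
structure IsInvariantLagrangian (ω : LinearMap.BilinForm K V) (x : Module.End K V)
    (L : Submodule K V) : Prop where
  isotropic : ∀ u ∈ L, ∀ v ∈ L, ω u v = 0
  stable : ∀ u ∈ L, x u ∈ L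
  finrank_eq : 2 * Module.finrank K L = Module.finrank K V

/-- Generators `e i`, `f i` of the symplectic `K[x]`-module `Z^⊥ / Z`, for an isotropic submodule
`Z`, which exhibit it as the sum of the modules `(K[x] / x ^ n i) ^ 2` with the standard form. -/
structure IsJordanFrame {ι : Type*} [Fintype ι] [DecidableEq ι] (ω : LinearMap.BilinForm K V)
    (x : Module.End K V) (Z : Submodule K V) (n : ι → ℕ) (e f : ι → V) : Prop where
  isotropic : ∀ u ∈ Z, ∀ v ∈ Z, ω u v = 0
  stable : ∀ u ∈ Z, x u ∈ Z
  perp_left : ∀ z ∈ Z, ∀ i, ω z (e i) = 0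
  perp_right : ∀ z ∈ Z, ∀ i, ω z (f i) = 0
  pow_left : ∀ i, (x ^ n i) (e i) ∈ Z
  pow_right : ∀ i, (x ^ n i) (f i) ∈ Z
  pair : ∀ s i j, ω ((x ^ s) (e i)) (f j) = if i = j ∧ s + 1 = n i then 1 else 0
  pair_left : ∀ s i j, ω ((x ^ s) (e i)) (e j) = 0
  pair_right : ∀ s i j, ω ((x ^ s) (f i)) (f j) = 0
  finrank_eq : 2 * (Module.finrank K Z + ∑ i, n i) = Module.finrank K V

variable {ω : LinearMap.BilinForm K V} {x : Module.End K V}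

theorem pow_mem_of_stable {Z : Submodule K V} (h : ∀ u ∈ Z, x u ∈ Z) (s : ℕ) {u : V}
    (hu : u ∈ Z) : (x ^ s) u ∈ Z := by
  induction s with
  | zero => simpa using hu
  | succ s ih => rw [pow_succ', Module.End.mul_apply]; exact h _ ih

theorem pow_mem_of_pow_mem {Z : Submodule K V} (h : ∀ u ∈ Z, x u ∈ Z) {s t : ℕ} (hst : s ≤ t)
    {u : V} (hu : (x ^ s) u ∈ Z) : (x ^ t) u ∈ Z := by
  obtain ⟨r, rfl⟩ := Nat.exists_eq_add_of_le hst
  rw [add_comm, pow_add, Module.End.mul_apply]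
  exact pow_mem_of_stable h r hu

namespace IsSelfAdjointPair

variable (h : IsSelfAdjointPair ω x)
include h

theorem selfAdjoint_pow (s : ℕ) (u v : V) : ω ((x ^ s) u) v = ω u ((x ^ s) v) := by
  induction s generalizing u with
  | zero => simp
  | succ s ih => rw [pow_succ, Module.End.mul_apply, ih, h.selfAdjoint, ← Module.End.mul_apply,
      ← pow_succ', ← pow_succ]

theorem pow_pow (s t : ℕ) (u v : V) : ω ((x ^ s) u) ((x ^ t) v) = ω ((x ^ (s + t)) u) v := by
  rw [← h.selfAdjoint_pow, ← Module.End.mul_apply, ← pow_add, add_comm]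

theorem skew (u v : V) : ω u v = -ω v u := (h.alt.neg_eq v u).symm

end IsSelfAdjointPair

namespace IsJordanFrame

variable {ι : Type*} [Fintype ι] [DecidableEq ι] {Z : Submodule K V} {n : ι → ℕ} {e f : ι → V}
  (hω : IsSelfAdjointPair ω x) (hF : IsJordanFrame ω x Z n e f)

section

include hω hF

theorem perp_left_pow {z : V} (hz : z ∈ Z) (s : ℕ) (i : ι) : ω z ((x ^ s) (e i)) = 0 := by
  rw [← hω.selfAdjoint_pow]
  exact hF.perp_left _ (pow_mem_of_stable hF.stable s hz) i

theorem perp_right_pow {z : V} (hz : z ∈ Z) (s : ℕ) (i : ι) : ω z ((x ^ s) (f i)) = 0 := by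
  rw [← hω.selfAdjoint_pow]
  exact hF.perp_right _ (pow_mem_of_stable hF.stable s hz) i

theorem pair' (s : ℕ) (i j : ι) :
    ω ((x ^ s) (f i)) (e j) = if i = j ∧ s + 1 = n i then -1 else 0 := by
  rw [hω.skew, ← hω.selfAdjoint_pow, hF.pair]
  by_cases h : i = j
  · subst h; split_ifs <;> simp
  · simp [h, Ne.symm h]

/-- Exchanging the two halves of a frame. -/
theorem swap : IsJordanFrame ω x Z n f (fun i => -e i) where
  isotropic := hF.isotropic
  stable := hF.stable
  perp_left := hF.perp_right
  perp_right z hz i := by rw [map_neg, hF.perp_left z hz, neg_zero]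
  pow_left := hF.pow_right
  pow_right i := by rw [map_neg]; exact Z.neg_mem (hF.pow_left i)
  pair s i j := by
    rw [map_neg, hF.pair' hω]
    split_ifs <;> simp
  pair_left := hF.pair_right
  pair_right s i j := by simp [hF.pair_left]
  finrank_eq := hF.finrank_eq

/-- Adding to `e j` multiples of the other `e i` that have at least the same order. -/
theorem change_left (j : ι) (a : ι → K) (ha : ∀ i, n i < n j → a i = 0) (haj : a j = 0) :
    IsJordanFrame ω x Z n
      (fun i => if i = j then e j + ∑ l, a l • (x ^ (n l - n j)) (e l) else e i)
      (fun i => f i - a i • f j) where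
  isotropic := hF.isotropic
  stable := hF.stable
  perp_left z hz i := by
    split_ifs with hi
    · simp [hF.perp_left z hz, hF.perp_left_pow hω hz]
    · exact hF.perp_left z hz i
  perp_right z hz i := by simp [hF.perp_right z hz]
  pow_left i := by
    split_ifs with hi
    · subst hi
      rw [map_add, map_sum]
      refine Z.add_mem (hF.pow_left i) (Z.sum_mem fun l _ => ?_)
      by_cases hl : n l < n i
      · simp [ha l hl]
      · rw [map_smul, ← Module.End.mul_apply, ← pow_add, Nat.add_sub_cancel' (not_lt.1 hl)]
        exact Z.smul_mem _ (hF.pow_left l)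
    · exact hF.pow_left i
  pow_right i := by
    rw [map_sub, map_smul]
    refine Z.sub_mem (hF.pow_right i) ?_
    by_cases hi : n i < n j
    · simp [ha i hi]
    · exact Z.smul_mem _ (pow_mem_of_pow_mem hF.stable (not_lt.1 hi) (hF.pow_right j))
  pair s i l := by
    split_ifs with hi h h
    · obtain ⟨rfl, hs⟩ := h
      subst hi
      simp only [map_add, map_sub, map_sum, map_smul, LinearMap.add_apply, LinearMap.sum_apply,
        LinearMap.smul_apply, ← Module.End.mul_apply, ← pow_add, hF.pair, haj]
      rw [Finset.sum_eq_zero]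
      · simp [hs]
      · intro m _
        by_cases hm : m = i
        · simp [hm, haj]
        · simp [hm]
    · subst hi
      simp only [map_add, map_sub, map_sum, map_smul, LinearMap.add_apply, LinearMap.sum_apply,
        LinearMap.smul_apply, ← Module.End.mul_apply, ← pow_add, hF.pair]
      have h1 : ∀ m, a m * (if m = i ∧ s + (n m - n i) + 1 = n m then (1 : K) else 0) = 0 := by
        intro m
        by_cases hm : m = i
        · simp [hm, haj]
        · simp [hm]
      have h2 : ∀ m, a m * (if m = l ∧ s + (n m - n i) + 1 = n m then (1 : K) else 0) =
          if m = l then a l * (if s + 1 = n i then 1 else 0) else 0 := by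
        intro m
        by_cases hm : m = l
        · subst hm
          by_cases hlt : n m < n i
          · simp [ha m hlt]
          -- The power `n m - n i` aligns the socle of block `m` with that of block `i`; the
          -- subtraction is not truncated, since `n i ≤ n m` here.
          · have : s + (n m - n i) + 1 = n m ↔ s + 1 = n i := by omega
            simp [this]
        · simp [hm]
      simp only [smul_eq_mul, h1, h2]
      by_cases hl : i = l
      · subst hl
        simp [haj] at h ⊢
        exact h
      · simp [hl]
    · obtain ⟨rfl, hs⟩ := h
      simp [hF.pair, hs, hi]
    · simp only [map_sub, map_smul, hF.pair]
      simp [hi, h]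
  pair_left s i l := by
    split_ifs with hi hl hl <;>
      simp [← Module.End.mul_apply, ← pow_add, hω.pow_pow, hF.pair_left]
  pair_right s i l := by simp [hF.pair_right]
  finrank_eq := hF.finrank_eq

/-- Adding to `e j` multiples of the `f i` that have at least the same order. -/
theorem change_right (j : ι) (b : ι → K) (hb : ∀ i, n i < n j → b i = 0) :
    IsJordanFrame ω x Z n
      (fun i => if i = j then e j + ∑ l, b l • (x ^ (n l - n j)) (f l) else e i + b i • f j)
      f where
  isotropic := hF.isotropic
  stable := hF.stable
  perp_left z hz i := by
    split_ifs with hi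
    · simp [hF.perp_left z hz, hF.perp_right_pow hω hz]
    · simp [hF.perp_left z hz, hF.perp_right z hz]
  perp_right := hF.perp_right
  pow_left i := by
    split_ifs with hi
    · subst hi
      rw [map_add, map_sum]
      refine Z.add_mem (hF.pow_left i) (Z.sum_mem fun l _ => ?_)
      by_cases hl : n l < n i
      · simp [hb l hl]
      · rw [map_smul, ← Module.End.mul_apply, ← pow_add, Nat.add_sub_cancel' (not_lt.1 hl)]
        exact Z.smul_mem _ (hF.pow_right l)
    · rw [map_add, map_smul]
      refine Z.add_mem (hF.pow_left i) ?_
      by_cases hi : n i < n j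
      · simp [hb i hi]
      · exact Z.smul_mem _ (pow_mem_of_pow_mem hF.stable (not_lt.1 hi) (hF.pow_right j))
  pow_right := hF.pow_right
  pair s i l := by
    have h0 : ∀ m, ω ((x ^ s) ((x ^ m) (f i))) (f l) = 0 := fun m => by
      rw [← Module.End.mul_apply, ← pow_add, hF.pair_right]
    split_ifs with hi h h
    · subst hi
      simp [← Module.End.mul_apply, ← pow_add, hF.pair, hF.pair_right, h]
    · subst hi
      simp [← Module.End.mul_apply, ← pow_add, hF.pair, hF.pair_right, h]
    · simp [hF.pair, hF.pair_right, h]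
    · simp [hF.pair, hF.pair_right, h]
  pair_left s i l := by
    -- Changing `e j` and changing the other `e i` contribute to the pairings with opposite signs,
    -- and the two contributions cancel.
    have key : ∀ m, b m * (if m = l ∧ s + (n m - n j) + 1 = n m then (-1 : K) else 0) =
        if m = l then -(b l * (if s + 1 = n j then 1 else 0)) else 0 := by
      intro m
      by_cases hm : m = l
      · subst hm
        by_cases hlt : n m < n j
        · simp [hb m hlt]
        · have : s + (n m - n j) + 1 = n m ↔ s + 1 = n j := by omega
          simp only [this, true_and, if_true]
          split_ifs <;> simp
      · simp [hm]
    have key' : ∀ m, b m * (if i = m ∧ s + (n m - n j) + 1 = n i then (1 : K) else 0) =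
        if m = i then b i * (if s + 1 = n j then 1 else 0) else 0 := by
      intro m
      by_cases hm : m = i
      · subst hm
        by_cases hlt : n m < n j
        · simp [hb m hlt]
        · have : s + (n m - n j) + 1 = n m ↔ s + 1 = n j := by omega
          simp [this]
      · simp [hm, Ne.symm hm]
    split_ifs with hi hl hl
    · subst hi
      subst hl
      simp only [map_add, map_sum, map_smul, LinearMap.add_apply, LinearMap.sum_apply,
        LinearMap.smul_apply, ← Module.End.mul_apply, ← pow_add, hω.pow_pow, hF.pair,
        hF.pair' hω, hF.pair_left, hF.pair_right, smul_eq_mul, mul_zero,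
        Finset.sum_const_zero, add_zero, zero_add, key, key']
      simp
    · subst hi
      simp only [map_add, map_sum, map_smul, LinearMap.add_apply, LinearMap.sum_apply,
        LinearMap.smul_apply, ← Module.End.mul_apply, ← pow_add, hF.pair,
        hF.pair' hω, hF.pair_left, hF.pair_right, smul_eq_mul, key]
      simp
    · subst hl
      simp only [map_add, map_sum, map_smul, LinearMap.add_apply, LinearMap.smul_apply,
        hω.pow_pow, hF.pair, hF.pair' hω, hF.pair_left, hF.pair_right, smul_eq_mul, mul_zero,
        add_zero, zero_add, key']
      by_cases hs : s + 1 = n l <;> simp [hs]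
    · simp only [map_add, map_smul, LinearMap.add_apply, LinearMap.smul_apply, hF.pair,
        hF.pair' hω, hF.pair_left, hF.pair_right]
      simp [hi, Ne.symm hl]
  pair_right := hF.pair_right
  finrank_eq := hF.finrank_eq

/-- Reduction by the socle vector of `e j`. -/
theorem reduce [FiniteDimensional K V] {j : ι} (hj : 0 < n j) :
    IsJordanFrame ω x (Z ⊔ Submodule.span K {(x ^ (n j - 1)) (e j)})
      (Function.update n j (n j - 1)) e (Function.update f j (x (f j))) := by
  set v := (x ^ (n j - 1)) (e j) with hv
  have hxv : x v ∈ Z := by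
    rw [hv, ← Module.End.mul_apply, ← pow_succ', Nat.sub_add_cancel hj]
    exact hF.pow_left j
  have hvZ : ∀ z ∈ Z, ω z v = 0 := fun z hz => hF.perp_left_pow hω hz _ _
  -- This pairing shows that `v` is outside `Z`, and that `f j` is not orthogonal to the enlarged
  -- submodule, which is why `x (f j)` replaces it.
  have hvf : ω v (f j) = 1 := by rw [hv, hF.pair, if_pos ⟨rfl, Nat.sub_add_cancel hj⟩]
  have hmem : ∀ u, u ∈ Z ⊔ Submodule.span K {v} → ∃ z ∈ Z, ∃ c : K, u = z + c • v := by
    intro u hu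
    obtain ⟨z, hz, w, hw, rfl⟩ := Submodule.mem_sup.1 hu
    obtain ⟨c, rfl⟩ := Submodule.mem_span_singleton.1 hw
    exact ⟨z, hz, c, rfl⟩
  have hle : Z ≤ Z ⊔ Submodule.span K {v} := le_sup_left
  have hstable : ∀ u ∈ Z ⊔ Submodule.span K {v}, x u ∈ Z ⊔ Submodule.span K {v} := by
    intro u hu
    obtain ⟨z, hz, c, rfl⟩ := hmem u hu
    rw [map_add, map_smul]
    exact hle (Z.add_mem (hF.stable z hz) (Z.smul_mem c hxv))
  have hvmem : v ∈ Z ⊔ Submodule.span K {v} :=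
    Submodule.mem_sup_right (Submodule.mem_span_singleton_self v)
  have hn := sum_eq_sum_update_add_one hj
  refine ⟨?_, hstable, ?_, ?_, ?_, ?_, ?_, hF.pair_left, ?_, ?_⟩
  · intro u hu w hw
    obtain ⟨z, hz, c, rfl⟩ := hmem u hu
    obtain ⟨z', hz', c', rfl⟩ := hmem w hw
    have h1 : ω v z' = 0 := by rw [hω.skew, hvZ z' hz', neg_zero]
    have h2 : ω v v = 0 := hω.alt v
    simp [hF.isotropic z hz z' hz', hvZ z hz, h1, h2]
  · intro u hu i
    obtain ⟨z, hz, c, rfl⟩ := hmem u hu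
    simp [hF.perp_left z hz, hv, hF.pair_left]
  · intro u hu i
    obtain ⟨z, hz, c, rfl⟩ := hmem u hu
    by_cases hi : i = j
    · subst hi
      rw [Function.update_self, ← hω.selfAdjoint, map_add, map_smul, map_add, map_smul,
        LinearMap.add_apply, LinearMap.smul_apply, hF.perp_right _ (hF.stable z hz),
        hF.perp_right _ hxv]
      simp
    · rw [Function.update_of_ne hi, map_add, map_smul, LinearMap.add_apply, LinearMap.smul_apply,
        hF.perp_right z hz, hv, hF.pair, if_neg (fun h => hi h.1.symm)]
      simp
  · intro i
    by_cases hi : i = j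
    · subst hi
      rw [Function.update_self]
      exact hvmem
    · rw [Function.update_of_ne hi]
      exact hle (hF.pow_left i)
  · intro i
    by_cases hi : i = j
    · subst hi
      rw [Function.update_self, Function.update_self, ← Module.End.mul_apply, ← pow_succ,
        Nat.sub_add_cancel hj]
      exact hle (hF.pow_right i)
    · rw [Function.update_of_ne hi, Function.update_of_ne hi]
      exact hle (hF.pow_right i)
  · intro s i l
    by_cases hl : l = j
    · subst hl
      rw [Function.update_self, ← hω.selfAdjoint, ← Module.End.mul_apply, ← pow_succ', hF.pair]
      by_cases hi : i = l
      · subst hi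
        rw [Function.update_self]
        have : s + 1 + 1 = n i ↔ s + 1 = n i - 1 := by omega
        simp [this]
      · simp [hi]
    · rw [Function.update_of_ne hl, hF.pair]
      by_cases hi : i = l
      · subst hi
        rw [Function.update_of_ne hl]
      · simp [hi]
  · intro s i l
    have h0 : ∀ m m' i l, ω ((x ^ m) (f i)) ((x ^ m') (f l)) = 0 := fun m m' i l => by
      rw [hω.pow_pow, hF.pair_right]
    have h1 : ∀ i, ∃ m i', Function.update f j (x (f j)) i = (x ^ m) (f i') := by
      intro i
      by_cases hi : i = j
      · subst hi
        exact ⟨1, i, by simp⟩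
      · exact ⟨0, i, by simp [hi]⟩
    obtain ⟨m, i', hi'⟩ := h1 i
    obtain ⟨m', l', hl'⟩ := h1 l
    rw [hi', hl', ← Module.End.mul_apply, ← pow_add, h0]
  · rw [← hF.finrank_eq, hn]
    have h1 := finrank_sup_span_of_dual (Z := Z) (g := fun _ : Unit => v)
      (φ := fun _ => ω.flip (f j)) (fun p q => by simpa using hvf)
      (fun q z hz => hF.perp_right z hz j)
    rw [Set.range_const, Fintype.card_unit] at h1
    rw [h1]
    ring

end

end IsJordanFrame

end JordanFrame

/-! ### Socle vectors in an invariant Lagrangian subspace. -/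

section Cover

variable {K V : Type*} [Field K] [AddCommGroup V] [Module K V]
  {ω : LinearMap.BilinForm K V} {x : Module.End K V}
  {ι : Type*} [Fintype ι] [DecidableEq ι] {Z L : Submodule K V} {n : ι → ℕ} {e f : ι → V}

namespace IsJordanFrame

/-- The submodule generated by `Z` and one half of a frame. -/
def half (x : Module.End K V) (Z : Submodule K V) (n : ι → ℕ) (e : ι → V) : Submodule K V :=
  Z ⊔ Submodule.span K (Set.range fun p : Σ i, Fin (n i) => (x ^ (p.2 : ℕ)) (e p.1))

omit [Fintype ι] [DecidableEq ι] in
theorem le_half : Z ≤ half x Z n e := le_sup_left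

omit [Fintype ι] [DecidableEq ι] in
theorem apply_eq_zero_of_mem_half {v : V} (hZ : ∀ z ∈ Z, ω z v = 0)
    (he : ∀ s i, ω ((x ^ s) (e i)) v = 0) {u : V} (hu : u ∈ half x Z n e) : ω u v = 0 := by
  have h : half x Z n e ≤ LinearMap.ker (LinearMap.flip ω v) := by
    refine sup_le (fun z hz => hZ z hz) (Submodule.span_le.2 ?_)
    rintro _ ⟨p, rfl⟩
    exact he _ _
  exact h hu

variable (hF : IsJordanFrame ω x Z n e f)

include hF in
theorem pow_mem_half (s : ℕ) (i : ι) : (x ^ s) (e i) ∈ half x Z n e := by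
  by_cases hs : s < n i
  · exact Submodule.mem_sup_right (Submodule.subset_span ⟨⟨i, s, hs⟩, rfl⟩)
  · exact le_half (pow_mem_of_pow_mem hF.stable (not_lt.1 hs) (hF.pow_left i))

include hF in
theorem half_stable {u : V} (hu : u ∈ half x Z n e) : x u ∈ half x Z n e := by
  have h : half x Z n e ≤ (half x Z n e).comap x := by
    refine sup_le (fun z hz => le_half (hF.stable z hz)) (Submodule.span_le.2 ?_)
    rintro _ ⟨p, rfl⟩
    change x ((x ^ (p.2 : ℕ)) (e p.1)) ∈ half x Z n e
    rw [← Module.End.mul_apply, ← pow_succ']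
    exact hF.pow_mem_half _ _
  exact h hu

variable (hω : IsSelfAdjointPair ω x)

include hω hF

theorem half_isotropic {u v : V} (hu : u ∈ half x Z n e) (hv : v ∈ half x Z n e) :
    ω u v = 0 := by
  refine apply_eq_zero_of_mem_half (fun z hz => ?_) (fun s i => ?_) hu
  · rw [hω.skew, neg_eq_zero]
    refine apply_eq_zero_of_mem_half (fun z' hz' => hF.isotropic z' hz' z hz) (fun s i => ?_) hv
    rw [hω.skew, hF.perp_left_pow hω hz, neg_zero]
  · rw [hω.skew, neg_eq_zero]
    refine apply_eq_zero_of_mem_half (fun z' hz' => hF.perp_left_pow hω hz' _ _)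
      (fun t j => ?_) hv
    rw [hω.pow_pow, hF.pair_left]

/-- The powers `x ^ t (f j)`, in reversed order, are dual to the powers `x ^ s (e i)`; so the latter
are independent modulo `Z` and their coefficients are pairings. -/
theorem dual_apply (p q : Σ i, Fin (n i)) :
    LinearMap.flip ω ((x ^ (n q.1 - 1 - q.2)) (f q.1)) ((x ^ (p.2 : ℕ)) (e p.1)) =
      if p = q then 1 else 0 := by
  obtain ⟨i, s⟩ := p
  obtain ⟨j, t⟩ := q
  rw [LinearMap.flip_apply, hω.pow_pow, hF.pair]
  by_cases hij : i = j
  · subst hij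
    have hs := s.2
    have ht := t.2
    have : (s : ℕ) + (n i - 1 - t) + 1 = n i ↔ s = t := by rw [Fin.ext_iff]; omega
    simp [this]
  · simp [hij]

theorem mem_of_mem_half {u : V} (hu : u ∈ half x Z n e) (h : ∀ t i, ω u ((x ^ t) (f i)) = 0) :
    u ∈ Z :=
  mem_of_mem_sup_span_of_dual (hF.dual_apply hω)
    (fun _ _ hz => hF.perp_right_pow hω hz _ _) hu fun _ => h _ _

theorem finrank_half [FiniteDimensional K V] :
    2 * Module.finrank K (half x Z n e) = Module.finrank K V := by
  rw [half, finrank_sup_span_of_dual (hF.dual_apply hω)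
    (fun _ _ hz => hF.perp_right_pow hω hz _ _), ← hF.finrank_eq]
  simp

theorem apply_right_eq_zero {u : V} (hu : u ∈ half x Z n e) {i : ι} {t : ℕ} (ht : n i ≤ t) :
    ω u ((x ^ t) (f i)) = 0 :=
  hF.half_isotropic hω hu (le_half (pow_mem_of_pow_mem hF.stable ht (hF.pow_right i)))

/-- A socle vector `w` of `half / Z` is determined by its pairings with the `f i`: those with higher
powers vanish because `ω(w, x ^ (t + 1) f) = ω(x w, x ^ t f)`. -/
theorem sub_sum_mem {w : V} (hw : w ∈ half x Z n e) (hxw : x w ∈ Z) :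
    w - ∑ i, ω w (f i) • (x ^ (n i - 1)) (e i) ∈ Z := by
  refine hF.mem_of_mem_half hω (Submodule.sub_mem _ hw (Submodule.sum_mem _ fun i _ =>
    Submodule.smul_mem _ _ (hF.pow_mem_half _ _))) fun t j => ?_
  simp only [map_sub, map_sum, map_smul, LinearMap.sub_apply, LinearMap.sum_apply,
    LinearMap.smul_apply, hω.pow_pow, hF.pair, smul_eq_mul]
  rw [Finset.sum_eq_single j (fun i _ hi => by simp [hi]) (fun h => absurd (Finset.mem_univ j) h)]
  rcases t with _ | t
  · by_cases hj : n j = 0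
    · have := hF.apply_right_eq_zero hω hw (i := j) (t := 0) (by omega)
      simp only [pow_zero, Module.End.one_apply] at this
      simp [this]
    · simp [show n j - 1 + 1 = n j by omega]
  · rw [pow_succ', Module.End.mul_apply, ← hω.selfAdjoint, hF.perp_right_pow hω hxw]
    by_cases hj : n j = 0
    · have := hF.apply_right_eq_zero hω hw (i := j) (t := 0) (by omega)
      simp only [pow_zero, Module.End.one_apply] at this
      simp [this]
    · simp [show n j - 1 + (t + 1) + 1 ≠ n j by omega]

/-- The exponent `∑ i, n i` exceeds or equals every `n i`, so `x` to this power sends each `f i`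
into `Z`. -/
theorem exists_pow_mem {u : V} (hu : u ∈ half x Z n e) : ∃ M, (x ^ M) u ∈ Z := by
  refine ⟨∑ i, n i, hF.mem_of_mem_half hω ?_ fun t i => ?_⟩
  · exact pow_mem_of_stable (fun u hu => hF.half_stable hu) _ hu
  · rw [hω.pow_pow, hω.selfAdjoint_pow]
    exact hF.apply_right_eq_zero hω hu
      ((Finset.single_le_sum (fun _ _ => Nat.zero_le _) (Finset.mem_univ i)).trans
        (Nat.le_add_right _ _))

omit hω hF [DecidableEq ι] in
theorem pow_add_sum {j : ι} (hj : 0 < n j) {a : ι → K} (ha : ∀ i, n i < n j → a i = 0) (v : V) :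
    (x ^ (n j - 1)) (v + ∑ l, a l • (x ^ (n l - n j)) (e l)) =
      (x ^ (n j - 1)) v + ∑ l, a l • (x ^ (n l - 1)) (e l) := by
  rw [map_add, map_sum]
  congr 1
  refine Finset.sum_congr rfl fun l _ => ?_
  by_cases hl : n l < n j
  · simp [ha l hl]
  · rw [map_smul, ← Module.End.mul_apply, ← pow_add,
      show n j - 1 + (n l - n j) = n l - 1 by omega]

/-- Multiplying `u` by the last power of `x` that stays outside `Z` gives a socle vector of `half /
Z` in `L`. Among the blocks occurring in it, a shortest one serves as `j`, and its coefficient is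
scaled to `1`. -/
theorem exists_left_of_not_le (hL : IsInvariantLagrangian ω x L) (hZL : Z ≤ L) {u : V}
    (hu : u ∈ half x Z n e) (huL : u ∈ L) (huZ : u ∉ Z) :
    ∃ j, 0 < n j ∧ ∃ a : ι → K, (∀ i, n i < n j → a i = 0) ∧ a j = 0 ∧
      (x ^ (n j - 1)) (e j + ∑ l, a l • (x ^ (n l - n j)) (e l)) ∈ L := by
  classical
  have hex := hF.exists_pow_mem hω hu
  obtain ⟨m, hm⟩ : ∃ m, Nat.find hex = m + 1 := by
    refine Nat.exists_eq_succ_of_ne_zero fun h => huZ ?_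
    have := Nat.find_spec hex
    rw [h] at this
    simpa using this
  have hwZ : (x ^ m) u ∉ Z := Nat.find_min hex (by omega)
  have hxw : x ((x ^ m) u) ∈ Z := by
    rw [← Module.End.mul_apply, ← pow_succ', ← hm]
    exact Nat.find_spec hex
  set w := (x ^ m) u with hw
  have hwP : w ∈ half x Z n e := pow_mem_of_stable (fun u hu => hF.half_stable hu) _ hu
  have hwL : w ∈ L := pow_mem_of_stable hL.stable _ huL
  have hsub := hF.sub_sum_mem hω hwP hxw
  have hsum : ∑ i, ω w (f i) • (x ^ (n i - 1)) (e i) ∈ L := by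
    have := L.sub_mem hwL (hZL hsub)
    rwa [sub_sub_cancel] at this
  have hne : (Finset.univ.filter fun i => ω w (f i) ≠ 0).Nonempty := by
    by_contra hemp
    rw [Finset.not_nonempty_iff_eq_empty, Finset.filter_eq_empty_iff] at hemp
    refine hwZ ?_
    rwa [Finset.sum_eq_zero (fun i hi => by simp [not_not.1 (hemp hi)]), sub_zero] at hsub
  obtain ⟨j, hj, hjmin⟩ := Finset.exists_min_image _ n hne
  rw [Finset.mem_filter] at hj
  have hmin : ∀ i, n i < n j → ω w (f i) = 0 := fun i hi => by
    by_contra h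
    exact absurd (hjmin i (Finset.mem_filter.2 ⟨Finset.mem_univ i, h⟩)) (not_le.2 hi)
  have hj0 : 0 < n j := by
    by_contra h
    have := hF.apply_right_eq_zero hω hwP (i := j) (t := 0) (by omega)
    exact hj.2 (by simpa using this)
  have ha : ∀ i, n i < n j → (if i = j then 0 else (ω w (f j))⁻¹ * ω w (f i)) = 0 := fun i hi => by
    rw [if_neg (by rintro rfl; exact lt_irrefl _ hi), hmin i hi, mul_zero]
  refine ⟨j, hj0, fun i => if i = j then 0 else (ω w (f j))⁻¹ * ω w (f i), ha, if_pos rfl, ?_⟩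
  rw [pow_add_sum hj0 ha]
  have := L.smul_mem (ω w (f j))⁻¹ hsum
  convert this using 1
  rw [Finset.smul_sum, ← Finset.add_sum_erase _ _ (Finset.mem_univ j),
    ← Finset.add_sum_erase (a := j) _ (fun i => (ω w (f j))⁻¹ • _) (Finset.mem_univ j)]
  simp only [if_true, zero_smul, zero_add]
  rw [smul_smul, inv_mul_cancel₀ hj.2, one_smul]
  congr 1
  refine Finset.sum_congr rfl fun i hi => ?_
  rw [if_neg (Finset.ne_of_mem_erase hi), smul_smul]

/-- If `L` meets `half` only in `Z`, then `L` and `half` together span `Z^⊥`, so a socle vector on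
the `f` side can be corrected by an element of `half` to lie in `L`. -/
theorem exists_right_of_le [FiniteDimensional K V] (hL : IsInvariantLagrangian ω x L)
    (hZL : Z ≤ L) (hn : 0 < ∑ i, n i) (hle : ∀ u ∈ half x Z n e, u ∈ L → u ∈ Z) :
    ∃ j, 0 < n j ∧ ∃ b : ι → K, (∀ i, n i < n j → b i = 0) ∧
      (x ^ (n j - 1)) (f j + ∑ l, b l • (x ^ (n l - n j)) (e l)) ∈ L := by
  have hne : (Finset.univ.filter fun i => 0 < n i).Nonempty := by
    by_contra hemp
    rw [Finset.not_nonempty_iff_eq_empty, Finset.filter_eq_empty_iff] at hemp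
    exact hn.ne' (Finset.sum_eq_zero fun i hi => by have := hemp hi; omega)
  -- A shortest nonzero block is taken, so that no coefficient can occur at a block shorter than `n
  -- j`.
  obtain ⟨j, hj, hjmin⟩ := Finset.exists_min_image _ n hne
  rw [Finset.mem_filter] at hj
  have hinf : L ⊓ half x Z n e = Z :=
    le_antisymm (fun u hu => hle u hu.2 hu.1) (le_inf hZL le_half)
  -- Both summands have half the dimension of `V` and meet in `Z`, so their sum has the dimension of
  -- the orthogonal of `Z`.
  have hsup : L ⊔ half x Z n e = LinearMap.BilinForm.orthogonal ω Z := by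
    refine Submodule.eq_of_le_of_finrank_eq (sup_le ?_ ?_) ?_
    · exact fun u hu z hz => hL.isotropic z (hZL hz) u hu
    · exact fun u hu z hz => hF.half_isotropic hω (le_half hz) hu
    · have h1 := Submodule.finrank_sup_add_finrank_inf_eq L (half x Z n e)
      have h2 := hF.finrank_half hω
      have h3 := hL.finrank_eq
      rw [hinf] at h1
      rw [LinearMap.BilinForm.finrank_orthogonal hω.nondegenerate]
      omega
  have hmem : (x ^ (n j - 1)) (f j) ∈ L ⊔ half x Z n e := by
    rw [hsup]
    exact fun z hz => hF.perp_right_pow hω hz _ _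
  obtain ⟨l, hl, p, hp, hlp⟩ := Submodule.mem_sup.1 hmem
  -- Both `x ^ n j (f j)` and `x l` lie in `L`, hence so does `x p`, which is also in `half`; thus
  -- `p` is a socle vector modulo `Z`.
  have hxp : x p ∈ Z := by
    refine hle _ (hF.half_stable hp) ?_
    have h1 : x p = x ((x ^ (n j - 1)) (f j)) - x l := by rw [← hlp, map_add, add_sub_cancel_left]
    rw [h1, ← Module.End.mul_apply, ← pow_succ', Nat.sub_add_cancel hj.2]
    exact L.sub_mem (hZL (hF.pow_right j)) (hL.stable l hl)
  have hb : ∀ i, n i < n j → -ω p (f i) = 0 := fun i hi => by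
    have hi0 : n i ≤ 0 := by
      by_contra h
      exact absurd (hjmin i (Finset.mem_filter.2 ⟨Finset.mem_univ i, not_le.1 h⟩)) (not_le.2 hi)
    have := hF.apply_right_eq_zero hω hp hi0
    simpa using this
  refine ⟨j, hj.2, fun i => -ω p (f i), hb, ?_⟩
  rw [pow_add_sum hj.2 hb, ← hlp, add_assoc]
  refine L.add_mem hl ?_
  simp only [neg_smul, Finset.sum_neg_distrib, ← sub_eq_add_neg]
  exact hZL (hF.sub_sum_mem hω hp hxp)

end IsJordanFrame

end Cover

/-! ### Counting parameters. -/

section Count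

variable {ι : Type*} [Fintype ι] [DecidableEq ι]

/-- Twice the dimension of the bi-Lagrangian Grassmannian of a Jordan sum of type `n`. -/
def lagWeight (n : ι → ℕ) : ℕ := ∑ i, ∑ j, min (n i) (n j) + ∑ i, n i

/-- Each `min (n i) (n j)` drops by one exactly when `n j ≤ n i`. Off the diagonal such pairs count
twice; the diagonal term and the linear term supply the remaining two. -/
theorem lagWeight_update {n : ι → ℕ} {j : ι} (hj : 0 < n j) :
    lagWeight (Function.update n j (n j - 1)) + 2 * Fintype.card {i // n j ≤ n i} =
      lagWeight n := by
  have h1 : ∀ i k, min (n i) (n k) = min (Function.update n j (n j - 1) i)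
      (Function.update n j (n j - 1) k) + ((if k = j then (if n j ≤ n i then 1 else 0) else 0) +
        (if i = j then (if n j ≤ n k then if k = j then 0 else 1 else 0) else 0)) := by
    intro i k
    by_cases hi : i = j <;> by_cases hk : k = j
    · subst hi; subst hk; simp; omega
    · subst hi; simp [hk]; split_ifs <;> omega
    · subst hk; simp [hi]; split_ifs <;> omega
    · simp [hi, hk]
  have h2 : ∀ k, (if n j ≤ n k then if k = j then 0 else 1 else 0) + (if k = j then 1 else 0) =
      if n j ≤ n k then 1 else 0 := by
    intro k
    by_cases hk : k = j
    · subst hk; simp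
    · simp [hk]
  have h3 : ∑ k, (if n j ≤ n k then if k = j then 0 else 1 else 0) + 1 =
      Fintype.card {i // n j ≤ n i} := by
    rw [Fintype.card_subtype, Finset.card_filter, ← Finset.sum_congr rfl fun k _ => h2 k,
      Finset.sum_add_distrib]
    simp
  have h4 : ∑ i, ∑ k, min (n i) (n k) = ∑ i, ∑ k, min (Function.update n j (n j - 1) i)
      (Function.update n j (n j - 1) k) + (∑ k, (if n j ≤ n k then 1 else 0) +
        ∑ k, (if n j ≤ n k then if k = j then 0 else 1 else 0)) := by
    rw [Finset.sum_congr rfl fun i _ => Finset.sum_congr rfl fun k _ => h1 i k]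
    simp only [Finset.sum_add_distrib]
    congr 2
    · simp
    · rw [Finset.sum_comm]
      simp
  have h5 : ∑ k, (if n j ≤ n k then 1 else 0) = Fintype.card {i // n j ≤ n i} := by
    rw [Fintype.card_subtype, Finset.card_filter]
  have h6 := sum_eq_sum_update_add_one hj
  simp only [lagWeight]
  omega

end Count

/-! ### Parametrization of the invariant Lagrangian subspaces. -/

section Parametrization

variable {K V : Type*} [Field K] [AddCommGroup V] [Module K V]

theorem IsParametrized.mono {k d : ℕ} {S T : Set (Submodule K V)} (hT : IsParametrized k d T)
    (h : S ⊆ T) : IsParametrized k d S := by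
  obtain ⟨F, hF, hp, hc⟩ := hT
  exact ⟨F, hF, hp, fun L hL => hc L (h hL)⟩

theorem IsParametrized.iUnion {k d : ℕ} {I : Type*} [Finite I] {S : I → Set (Submodule K V)}
    (h : ∀ i, IsParametrized k d (S i)) : IsParametrized k d (⋃ i, S i) := by
  choose F hF hp hc using h
  refine ⟨⋃ i, F i, Set.finite_iUnion hF, ?_, ?_⟩
  · intro Φ hΦ
    obtain ⟨i, hi⟩ := Set.mem_iUnion.1 hΦ
    exact hp i Φ hi
  · intro L hL
    obtain ⟨i, hi⟩ := Set.mem_iUnion.1 hL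
    obtain ⟨Φ, hΦ, hs⟩ := hc i L hi
    exact ⟨Φ, Set.mem_iUnion.2 ⟨i, hΦ⟩, hs⟩

theorem isPolyMap_comp_funLeft {σ τ : Type*} {g : (τ → K) → V} (hg : IsPolyMap (K := K) g)
    (r : τ → σ) : IsPolyMap (K := K) (fun s : σ → K => g (s ∘ r)) :=
  hg.comp (isPolyMap_linear (LinearMap.funLeft K K r))

theorem coord_mem_polyFun {σ : Type*} (i : σ) : (fun s : σ → K => s i) ∈ polyFun K (σ → K) :=
  dual_mem_polyFun (LinearMap.proj (R := K) (φ := fun _ : σ => K) i)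

variable [FiniteDimensional K V] {ω : LinearMap.BilinForm K V} {x : Module.End K V}

/-- Extension by zero of a vector of coordinates. -/
def extendZero {ι : Type*} (p : ι → Prop) [DecidablePred p] (a : {i // p i} → K) (i : ι) : K :=
  if h : p i then a ⟨i, h⟩ else 0

/-- The invariant Lagrangian subspaces containing a member of a polynomial family of isotropic
submodules with frames of type `n` depend on `card τ + lagWeight n / 2` parameters. -/
theorem isParametrized_of_frames (hω : IsSelfAdjointPair ω x) {ι : Type} [Fintype ι]
    [DecidableEq ι] (k d m : ℕ) : ∀ (n : ι → ℕ) (_ : ∑ i, n i = m) (τ κ : Type) [Fintype τ]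
    [Fintype κ] (z : (τ → K) → κ → V) (e f : (τ → K) → ι → V)
    (_ : ∀ c, IsPolyMap (K := K) fun t => z t c) (_ : ∀ i, IsPolyMap (K := K) fun t => e t i)
    (_ : ∀ i, IsPolyMap (K := K) fun t => f t i)
    (_ : ∀ t, IsJordanFrame ω x (Submodule.span K (Set.range (z t))) n (e t) (f t))
    (_ : Fintype.card κ + m = k) (_ : 2 * Fintype.card τ + lagWeight n ≤ 2 * d),
    IsParametrized k d {L | IsInvariantLagrangian ω x L ∧
      ∃ t, Submodule.span K (Set.range (z t)) ≤ L} := by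
  induction m with
  | zero =>
    intro n hn τ κ _ _ z e f hz _ _ hF hk hd
    let g : Fin k ≃ κ := (Fintype.equivFinOfCardEq (by omega)).symm
    have hcard : Fintype.card τ ≤ Fintype.card (Fin d) := by rw [Fintype.card_fin]; omega
    obtain ⟨r⟩ := Function.Embedding.nonempty_of_card_le hcard
    refine ⟨{fun s i => z (s ∘ r) (g i)}, Set.finite_singleton _, ?_, ?_⟩
    · rintro _ rfl
      exact IsPolyMap.pi fun i => isPolyMap_comp_funLeft (hz _) r
    · rintro L ⟨hL, t, ht⟩
      refine ⟨_, rfl, Function.extend r t 0, ?_⟩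
      have h1 : Function.extend r t 0 ∘ r = t := Function.extend_comp r.injective t 0
      simp only [h1]
      have h2 : Set.range (fun i => z t (g i)) = Set.range (z t) :=
        g.surjective.range_comp (z t)
      rw [h2]
      -- When all `n i` are zero, the span of `z t` already has half the dimension of `V`, so it is
      -- all of `L`.
      refine (Submodule.eq_of_le_of_finrank_eq ht ?_).symm
      have h3 := (hF t).finrank_eq
      have h4 := hL.finrank_eq
      omega
  | succ m ih =>
    intro n hn τ κ _ _ z e f hz he hf hF hk hd
    -- After a change of frame with parameters indexed by `{i // n j ≤ n i}`, the socle vector of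
    -- `e' t j` joins the generators of `Z`, whence `Option κ`. The loss of `lagWeight` pays for the
    -- new parameters.
    have key : ∀ j, 0 < n j → ∀ e' f' : ((τ ⊕ {i // n j ≤ n i}) → K) → ι → V,
        (∀ i, IsPolyMap (K := K) fun t => e' t i) → (∀ i, IsPolyMap (K := K) fun t => f' t i) →
        (∀ t, IsJordanFrame ω x (Submodule.span K (Set.range (z (t ∘ Sum.inl)))) n
          (e' t) (f' t)) →
        IsParametrized k d {L | IsInvariantLagrangian ω x L ∧
          ∃ t, Submodule.span K (Set.range (z (t ∘ Sum.inl))) ≤ L ∧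
            (x ^ (n j - 1)) (e' t j) ∈ L} := by
      intro j hj e' f' he' hf' hF'
      have hspan : ∀ t, Submodule.span K (Set.range fun o : Option κ =>
          o.elim ((x ^ (n j - 1)) (e' t j)) (z (t ∘ Sum.inl))) =
          Submodule.span K (Set.range (z (t ∘ Sum.inl))) ⊔
            Submodule.span K {(x ^ (n j - 1)) (e' t j)} := by
        intro t
        rw [Option.range_eq, ← Submodule.span_union, Set.union_comm, Set.singleton_union]
        rfl
      have hlw := lagWeight_update hj
      have hsum := sum_eq_sum_update_add_one hj
      have hcard : Fintype.card (τ ⊕ {i // n j ≤ n i}) =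
        Fintype.card τ + Fintype.card {i // n j ≤ n i} := Fintype.card_sum
      refine (ih (Function.update n j (n j - 1)) (by omega) (τ ⊕ {i // n j ≤ n i}) (Option κ)
        (fun t o => o.elim ((x ^ (n j - 1)) (e' t j)) (z (t ∘ Sum.inl))) e'
        (fun t => Function.update (f' t) j (x (f' t j))) ?_ he' ?_ ?_ ?_ ?_).mono ?_
      · rintro (_ | c)
        · exact (he' j).linear_comp _
        · exact isPolyMap_comp_funLeft (hz c) _
      · intro i
        by_cases hi : i = j
        · subst hi
          simpa using (hf' i).linear_comp x
        · simpa [hi] using hf' i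
      · intro t
        rw [hspan]
        exact (hF' t).reduce hω hj
      · rw [Fintype.card_option]; omega
      · omega
      · rintro L ⟨hL, t, ht, ht'⟩
        refine ⟨hL, t, ?_⟩
        rw [hspan]
        exact sup_le ht ((Submodule.span_singleton_le_iff_mem _ _).2 ht')
    have hext : ∀ (j i : ι), (fun t : (τ ⊕ {i // n j ≤ n i}) → K =>
        extendZero (fun i => n j ≤ n i) (t ∘ Sum.inr) i) ∈ polyFun K _ := by
      intro j i
      simp only [extendZero]
      split_ifs with h
      · exact coord_mem_polyFun _
      · exact const_mem_polyFun 0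
    have hext0 : ∀ (j i : ι) (a : {i // n j ≤ n i} → K), n i < n j →
        extendZero (fun i => n j ≤ n i) a i = 0 := fun j i a hi => dif_neg (not_le.2 hi)
    have hlift : ∀ (j : ι) (t : τ → K) (a : ι → K), (∀ i, n i < n j → a i = 0) →
        ∃ t' : (τ ⊕ {i // n j ≤ n i}) → K, t' ∘ Sum.inl = t ∧
          extendZero (fun i => n j ≤ n i) (t' ∘ Sum.inr) = a := by
      intro j t a ha
      refine ⟨Sum.elim t fun i => a i, rfl, ?_⟩
      ext i
      simp only [extendZero]
      split_ifs with h
      · rfl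
      · exact (ha i (not_le.1 h)).symm
    have hl : ∀ j, 0 < n j → IsParametrized k d {L | IsInvariantLagrangian ω x L ∧
        ∃ t, Submodule.span K (Set.range (z t)) ≤ L ∧ ∃ a : ι → K, (∀ i, n i < n j → a i = 0) ∧
          a j = 0 ∧ (x ^ (n j - 1)) (e t j + ∑ l, a l • (x ^ (n l - n j)) (e t l)) ∈ L} := by
      intro j hj
      -- The parameter at `j` is ignored here; it is present so that `key` covers both halves.
      let a : ((τ ⊕ {i // n j ≤ n i}) → K) → ι → K := fun t i =>
        if i = j then 0 else extendZero (fun i => n j ≤ n i) (t ∘ Sum.inr) i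
      have ha : ∀ i, (fun t => a t i) ∈ polyFun K _ := by
        intro i
        simp only [a]
        split_ifs
        · exact const_mem_polyFun 0
        · exact hext j i
      refine (key j hj _ _ ?_ ?_ fun t => (hF (t ∘ Sum.inl)).change_left hω j (a t)
        (fun i hi => ?_) (if_pos rfl)).mono ?_
      · intro i
        have h1 := fun i => isPolyMap_comp_funLeft (σ := τ ⊕ {i // n j ≤ n i}) (he i) Sum.inl
        by_cases hi : i = j
        · simp only [hi, if_true]
          exact (h1 j).add (IsPolyMap.sum _ fun l _ => ((h1 l).linear_comp _).smul (ha l))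
        · simpa only [hi, if_false] using h1 i
      · intro i
        have h1 := fun i => isPolyMap_comp_funLeft (σ := τ ⊕ {i // n j ≤ n i}) (hf i) Sum.inl
        exact (h1 i).sub ((h1 j).smul (ha i))
      · simp only [a, hext0 j i _ hi, ite_self]
      · rintro L ⟨hL, t, ht, b, hb, hbj, hmem⟩
        obtain ⟨t', rfl, hb'⟩ := hlift j t b hb
        have hab : a t' = b := by
          ext i
          simp only [a, hb']
          split_ifs with hi
          · rw [hi, hbj]
          · rfl
        refine ⟨hL, t', ht, ?_⟩
        simpa only [if_true, hab] using hmem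
    have hr : ∀ j, 0 < n j → IsParametrized k d {L | IsInvariantLagrangian ω x L ∧
        ∃ t, Submodule.span K (Set.range (z t)) ≤ L ∧ ∃ b : ι → K, (∀ i, n i < n j → b i = 0) ∧
          (x ^ (n j - 1)) (f t j + ∑ l, b l • (x ^ (n l - n j)) (e t l)) ∈ L} := by
      intro j hj
      let b : ((τ ⊕ {i // n j ≤ n i}) → K) → ι → K := fun t =>
        extendZero (fun i => n j ≤ n i) (t ∘ Sum.inr)
      refine (key j hj _ _ ?_ ?_ fun t => ((hF (t ∘ Sum.inl)).swap hω).change_right hω j (b t)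
        (fun i hi => hext0 j i _ hi)).mono ?_
      · intro i
        have h1 := fun i => isPolyMap_comp_funLeft (σ := τ ⊕ {i // n j ≤ n i}) (he i) Sum.inl
        have h2 := fun i => isPolyMap_comp_funLeft (σ := τ ⊕ {i // n j ≤ n i}) (hf i) Sum.inl
        by_cases hi : i = j
        · simp only [hi, if_true]
          exact (h2 j).add (IsPolyMap.sum _ fun l _ =>
            ((h1 l).neg.linear_comp _).smul (hext j l))
        · simp only [hi, if_false]
          exact (h2 i).add ((h1 j).neg.smul (hext j i))
      · exact fun i => (isPolyMap_comp_funLeft (he i) Sum.inl).neg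
      · rintro L ⟨hL, t, ht, c, hc, hmem⟩
        -- The swapped frame has `-e` as its second half, hence the sign.
        obtain ⟨t', rfl, hc'⟩ := hlift j t (fun i => -c i) fun i hi => by rw [hc i hi, neg_zero]
        refine ⟨hL, t', ht, ?_⟩
        simpa only [if_true, b, hc', map_neg, neg_smul, smul_neg, neg_neg] using hmem
    refine (IsParametrized.iUnion (I := {j // 0 < n j} × Bool) (S := fun p =>
      if p.2 then {L | IsInvariantLagrangian ω x L ∧
        ∃ t, Submodule.span K (Set.range (z t)) ≤ L ∧ ∃ a : ι → K,
          (∀ i, n i < n p.1 → a i = 0) ∧ a p.1 = 0 ∧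
          (x ^ (n p.1 - 1)) (e t p.1 + ∑ l, a l • (x ^ (n l - n p.1)) (e t l)) ∈ L}
      else {L | IsInvariantLagrangian ω x L ∧
        ∃ t, Submodule.span K (Set.range (z t)) ≤ L ∧ ∃ b : ι → K,
          (∀ i, n i < n p.1 → b i = 0) ∧
          (x ^ (n p.1 - 1)) (f t p.1 + ∑ l, b l • (x ^ (n l - n p.1)) (e t l)) ∈ L})
      ?_).mono ?_
    · rintro ⟨⟨j, hj⟩, b⟩
      cases b
      · exact hr j hj
      · exact hl j hj
    · rintro L ⟨hL, t, ht⟩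
      by_cases hle : ∀ u ∈ IsJordanFrame.half x (Submodule.span K (Set.range (z t))) n (e t),
          u ∈ L → u ∈ Submodule.span K (Set.range (z t))
      · obtain ⟨j, hj, b, hb, hmem⟩ := (hF t).exists_right_of_le hω hL ht (by omega) hle
        exact Set.mem_iUnion.2 ⟨(⟨j, hj⟩, false), hL, t, ht, b, hb, hmem⟩
      · push Not at hle
        obtain ⟨u, hu, huL, huZ⟩ := hle
        obtain ⟨j, hj, a, ha, haj, hmem⟩ := (hF t).exists_left_of_not_le hω hL ht hu huL huZ
        exact Set.mem_iUnion.2 ⟨(⟨j, hj⟩, true), hL, t, ht, a, ha, haj, hmem⟩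

/-- For the module `⨁ (K[x] / x ^ n i) ^ 2` itself. -/
theorem isParametrized_of_frame (hω : IsSelfAdjointPair ω x) {ι : Type} [Fintype ι]
    [DecidableEq ι] {n : ι → ℕ} {e f : ι → V} (hF : IsJordanFrame ω x ⊥ n e f) {d : ℕ}
    (hd : lagWeight n = 2 * d) :
    IsParametrized (∑ i, n i) d {L | IsInvariantLagrangian ω x L} := by
  have h0 : ∀ t : Empty → K, Submodule.span K (Set.range fun c : Empty => (c.elim : V)) = ⊥ :=
    fun _ => by simp
  refine (isParametrized_of_frames hω (∑ i, n i) d (∑ i, n i) n rfl Empty Empty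
    (fun _ c => c.elim) (fun _ => e) (fun _ => f) (fun c => c.elim)
    (fun _ => isPolyMap_const _) (fun _ => isPolyMap_const _) (fun t => by rwa [h0 t])
    (by simp) (by simp [hd])).mono fun L hL => ⟨hL, fun _ => 0, ?_⟩
  rw [h0 fun _ => 0]
  exact bot_le

end Parametrization

/-- For decreasing `n`, the minimum is the value at the larger index: `n j` occurs for `j + 1`
indices `i ≤ j` and again for the `j` indices below it (counting from `0`), and the linear term adds
one more. -/
theorem two_mul_sum_eq_lagWeight {N : ℕ} {n : Fin N → ℕ} (hn : Antitone n) :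
    lagWeight n = 2 * ∑ j : Fin N, ((j : ℕ) + 1) * n j := by
  have h1 : ∀ i j, min (n i) (n j) = (if i ≤ j then n j else 0) + (if j < i then n i else 0) := by
    intro i j
    rcases le_or_gt i j with h | h
    · simp [h, not_lt.2 h, hn h]
    · simp [h, not_le.2 h, hn h.le]
  have h2 : ∀ j : Fin N, ∑ i, (if i ≤ j then n j else 0) = ((j : ℕ) + 1) * n j := by
    intro j
    rw [← Finset.sum_filter, Finset.sum_const, smul_eq_mul, Finset.filter_ge_eq_Iic, Fin.card_Iic]
  have h3 : ∀ i : Fin N, ∑ j, (if j < i then n i else 0) = (i : ℕ) * n i := by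
    intro i
    rw [← Finset.sum_filter, Finset.sum_const, smul_eq_mul, Finset.filter_gt_eq_Iio, Fin.card_Iio]
  rw [lagWeight]
  simp only [h1, Finset.sum_add_distrib]
  rw [Finset.sum_comm]
  simp only [h2, h3, ← Finset.sum_add_distrib, Finset.mul_sum]
  exact Finset.sum_congr rfl fun i _ => by ring

/-! ### From the Jordan sum to a symplectic `K[x]`-module. -/

section JordanBasis

variable {K V : Type*} [Field K] [AddCommGroup V] [Module K V] {N : ℕ} {n : Fin N → ℕ}

/-- A basis in which the pair `(ω, η)` is the direct sum of the standard blocks with nilpotent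
`η`. -/
structure IsJordanBasis (ω η : LinearMap.BilinForm K V)
    (b : Module.Basis (Σ j : Fin N, Fin (n j) ⊕ Fin (n j)) K V) : Prop where
  alt : ω.IsAlt
  alt' : η.IsAlt
  inl_inl : ∀ i s j t, ω (b ⟨i, .inl s⟩) (b ⟨j, .inl t⟩) = 0
  inr_inr : ∀ i s j t, ω (b ⟨i, .inr s⟩) (b ⟨j, .inr t⟩) = 0
  inl_inr : ∀ i s j t, ω (b ⟨i, .inl s⟩) (b ⟨j, .inr t⟩) =
    if i = j ∧ (s : ℕ) = t then 1 else 0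
  inl_inl' : ∀ i s j t, η (b ⟨i, .inl s⟩) (b ⟨j, .inl t⟩) = 0
  inr_inr' : ∀ i s j t, η (b ⟨i, .inr s⟩) (b ⟨j, .inr t⟩) = 0
  inl_inr' : ∀ i s j t, η (b ⟨i, .inl s⟩) (b ⟨j, .inr t⟩) =
    if i = j ∧ (s : ℕ) + 1 = t then 1 else 0

section Matrix

variable {b : Module.Basis (Σ j : Fin N, Fin (n j) ⊕ Fin (n j)) K V}
  {ω : LinearMap.BilinForm K V} {X : ∀ j, Matrix (Fin (n j)) (Fin (n j)) K}
  (h : LinearMap.BilinForm.toMatrix b ω = Matrix.blockDiagonal' fun j => skewBlock (X j))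
include h

theorem apply_of_toMatrix_eq_skewBlock (i : Fin N) (p q : Fin (n i) ⊕ Fin (n i)) :
    ω (b ⟨i, p⟩) (b ⟨i, q⟩) = skewBlock (X i) p q := by
  rw [← LinearMap.BilinForm.toMatrix_apply, h, Matrix.blockDiagonal'_apply_eq]

theorem apply_of_toMatrix_eq_skewBlock_ne {i j : Fin N} (hij : i ≠ j)
    (p : Fin (n i) ⊕ Fin (n i)) (q : Fin (n j) ⊕ Fin (n j)) : ω (b ⟨i, p⟩) (b ⟨j, q⟩) = 0 := by
  rw [← LinearMap.BilinForm.toMatrix_apply, h, Matrix.blockDiagonal'_apply_ne _ _ _ hij]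

theorem inl_inl_of_toMatrix (i s j t) : ω (b ⟨i, .inl s⟩) (b ⟨j, .inl t⟩) = 0 := by
  by_cases hij : i = j
  · subst hij
    rw [apply_of_toMatrix_eq_skewBlock h]
    simp [skewBlock]
  · exact apply_of_toMatrix_eq_skewBlock_ne h hij _ _

theorem inr_inr_of_toMatrix (i s j t) : ω (b ⟨i, .inr s⟩) (b ⟨j, .inr t⟩) = 0 := by
  by_cases hij : i = j
  · subst hij
    rw [apply_of_toMatrix_eq_skewBlock h]
    simp [skewBlock]
  · exact apply_of_toMatrix_eq_skewBlock_ne h hij _ _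

theorem inl_inr_of_toMatrix (μ : K) (hX : ∀ j, X j = jordanMatrix μ (n j)) (i s j t) :
    ω (b ⟨i, .inl s⟩) (b ⟨j, .inr t⟩) = (if i = j ∧ (s : ℕ) = t then μ else 0) +
      if i = j ∧ (s : ℕ) + 1 = t then 1 else 0 := by
  by_cases hij : i = j
  · subst hij
    rw [apply_of_toMatrix_eq_skewBlock h]
    simp only [skewBlock, Matrix.fromBlocks_apply₁₂, hX, jordanMatrix, Matrix.of_apply, Fin.ext_iff,
      true_and]
    split_ifs <;> first | omega | simp
  · rw [apply_of_toMatrix_eq_skewBlock_ne h hij]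
    simp [hij]

theorem inl_inr_of_toMatrix_one (hX : ∀ j, X j = 1) (i s j t) :
    ω (b ⟨i, .inl s⟩) (b ⟨j, .inr t⟩) = if i = j ∧ (s : ℕ) = t then 1 else 0 := by
  by_cases hij : i = j
  · subst hij
    rw [apply_of_toMatrix_eq_skewBlock h]
    simp [skewBlock, hX, Matrix.one_apply, Fin.ext_iff]
  · rw [apply_of_toMatrix_eq_skewBlock_ne h hij]
    simp [hij]

end Matrix

theorem SkewPencil.isBiIsotropic_iff {P : SkewPencil K V} {U : Submodule K V} :
    P.IsBiIsotropic U ↔ ∀ u ∈ U, ∀ v ∈ U, P.A u v = 0 ∧ P.B u v = 0 := by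
  constructor
  · intro h u hu v hv
    have h0 := h (some 0) u hu v hv
    have h1 := h none u hu v hv
    simp only [SkewPencil.form, zero_smul, add_zero] at h0 h1
    exact ⟨h0, h1⟩
  · rintro h (_ | μ) u hu v hv
    · exact (h u hu v hv).2
    · simp [SkewPencil.form, h u hu v hv]

/-- For finite `μ` the pair is `(B, A - μ B)`, for `∞` it is `(A, B)`. Either way the second form
has the nilpotent block, and the pair spans the same forms as `A` and `B`. -/
theorem SkewPencil.IsJordanSum.exists_isJordanBasis {P : SkewPencil K V} {lam : OnePoint K}
    (h : P.IsJordanSum lam n) : ∃ (ω η : LinearMap.BilinForm K V)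
      (b : Module.Basis (Σ j : Fin N, Fin (n j) ⊕ Fin (n j)) K V), IsJordanBasis ω η b ∧
      (∃ μ, P.form μ = ω) ∧
      ∀ U, P.IsBiIsotropic U ↔ ∀ u ∈ U, ∀ v ∈ U, ω u v = 0 ∧ η u v = 0 := by
  obtain ⟨b, hA, hB⟩ := h
  rcases lam with _ | μ
  · simp only [jordanBlockA, jordanBlockB] at hA hB
    refine ⟨P.A, P.B, b, ⟨P.isAlt_A, P.isAlt_B, inl_inl_of_toMatrix hA, inr_inr_of_toMatrix hA,
      inl_inr_of_toMatrix_one hA fun _ => rfl, inl_inl_of_toMatrix hB, inr_inr_of_toMatrix hB,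
      fun i s j t => ?_⟩, ⟨some 0, by simp [SkewPencil.form]⟩,
      fun U => SkewPencil.isBiIsotropic_iff⟩
    rw [inl_inr_of_toMatrix hB 0 fun _ => rfl]
    simp
  · simp only [jordanBlockA, jordanBlockB] at hA hB
    refine ⟨P.B, P.A - μ • P.B, b, ⟨P.isAlt_B, fun v => ?_, inl_inl_of_toMatrix hB,
      inr_inr_of_toMatrix hB, inl_inr_of_toMatrix_one hB fun _ => rfl, fun i s j t => ?_,
      fun i s j t => ?_, fun i s j t => ?_⟩, ⟨none, rfl⟩, fun U => ?_⟩
    · simp [P.isAlt_A v, P.isAlt_B v]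
    · simp [inl_inl_of_toMatrix hA, inl_inl_of_toMatrix hB]
    · simp [inr_inr_of_toMatrix hA, inr_inr_of_toMatrix hB]
    · simp only [LinearMap.sub_apply, LinearMap.smul_apply,
        inl_inr_of_toMatrix hA μ fun _ => rfl, inl_inr_of_toMatrix_one hB fun _ => rfl]
      split_ifs <;> simp
    · rw [SkewPencil.isBiIsotropic_iff]
      refine forall₂_congr fun u hu => forall₂_congr fun v hv => ?_
      constructor
      · rintro ⟨hAuv, hBuv⟩
        simp [hAuv, hBuv]
      · rintro ⟨hBuv, hAuv⟩
        refine ⟨?_, hBuv⟩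
        simpa [hBuv] using hAuv

namespace IsJordanBasis

variable {ω η : LinearMap.BilinForm K V}
  {b : Module.Basis (Σ j : Fin N, Fin (n j) ⊕ Fin (n j)) K V}

/-- The nilpotent operator that shifts the two halves of each block. -/
noncomputable def shift (b : Module.Basis (Σ j : Fin N, Fin (n j) ⊕ Fin (n j)) K V) :
    Module.End K V :=
  b.constr K fun
    | ⟨j, .inl s⟩ => if h : (s : ℕ) + 1 < n j then b ⟨j, .inl ⟨s + 1, h⟩⟩ else 0
    | ⟨j, .inr t⟩ => if 0 < (t : ℕ) then b ⟨j, .inr ⟨t - 1, by omega⟩⟩ else 0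

theorem shift_inl (j : Fin N) (s : Fin (n j)) : shift b (b ⟨j, .inl s⟩) =
    if h : (s : ℕ) + 1 < n j then b ⟨j, .inl ⟨s + 1, h⟩⟩ else 0 := by
  rw [shift, Module.Basis.constr_basis]

theorem shift_inr (j : Fin N) (t : Fin (n j)) : shift b (b ⟨j, .inr t⟩) =
    if 0 < (t : ℕ) then b ⟨j, .inr ⟨t - 1, by omega⟩⟩ else 0 := by
  rw [shift, Module.Basis.constr_basis]

variable (h : IsJordanBasis ω η b)
include h

theorem inr_inl (i s j t) : ω (b ⟨i, .inr s⟩) (b ⟨j, .inl t⟩) =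
    if i = j ∧ (s : ℕ) = t then -1 else 0 := by
  rw [← h.alt.neg_eq, h.inl_inr]
  simp only [eq_comm]
  split_ifs <;> simp

theorem inr_inl' (i s j t) : η (b ⟨i, .inr s⟩) (b ⟨j, .inl t⟩) =
    if i = j ∧ (t : ℕ) + 1 = s then -1 else 0 := by
  rw [← h.alt'.neg_eq, h.inl_inr']
  simp only [eq_comm (a := j)]
  split_ifs <;> simp

theorem shift_apply (u v : V) : ω (shift b u) v = η u v := by
  have : ω ∘ₗ shift b = η := by
    refine b.ext fun p => b.ext fun q => ?_
    obtain ⟨i, s | s⟩ := p <;> obtain ⟨j, t | t⟩ := q <;>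
      simp only [LinearMap.comp_apply, shift_inl, shift_inr]
    · rw [h.inl_inl']
      split_ifs <;> simp [h.inl_inl]
    · rw [h.inl_inr']
      have ht := t.2
      split_ifs with h1 h2 h2
      · rw [h.inl_inr, if_pos h2]
      · rw [h.inl_inr, if_neg h2]
      · obtain ⟨rfl, h2⟩ := h2
        omega
      · simp
    · rw [h.inr_inl']
      have hs := s.2
      split_ifs with h1 h2 h2
      · rw [h.inr_inl, if_pos ⟨h2.1, by simp only; omega⟩]
      · rw [h.inr_inl, if_neg fun h3 => h2 ⟨h3.1, by have := h3.2; simp only at this; omega⟩]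
      · omega
      · simp
    · rw [h.inr_inr']
      split_ifs <;> simp [h.inr_inr]
  rw [← this, LinearMap.comp_apply]

theorem apply_inr (u : V) (j : Fin N) (t : Fin (n j)) :
    ω u (b ⟨j, .inr t⟩) = b.coord ⟨j, .inl t⟩ u := by
  have : LinearMap.flip ω (b ⟨j, .inr t⟩) = b.coord ⟨j, .inl t⟩ := by
    refine b.ext fun p => ?_
    obtain ⟨i, s | s⟩ := p
    · rw [LinearMap.flip_apply, h.inl_inr, Module.Basis.coord_apply, Module.Basis.repr_self,
        Finsupp.single_apply]
      by_cases hij : i = j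
      · subst hij; simp [Fin.ext_iff]
      · simp [hij]
    · rw [LinearMap.flip_apply, h.inr_inr, Module.Basis.coord_apply, Module.Basis.repr_self,
        Finsupp.single_apply, if_neg]
      rintro ⟨⟩
  rw [← this, LinearMap.flip_apply]

theorem apply_inl (u : V) (j : Fin N) (t : Fin (n j)) :
    ω u (b ⟨j, .inl t⟩) = -b.coord ⟨j, .inr t⟩ u := by
  have : LinearMap.flip ω (b ⟨j, .inl t⟩) = -b.coord ⟨j, .inr t⟩ := by
    refine b.ext fun p => ?_
    obtain ⟨i, s | s⟩ := p
    · rw [LinearMap.flip_apply, h.inl_inl, LinearMap.neg_apply, Module.Basis.coord_apply,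
        Module.Basis.repr_self, Finsupp.single_apply, if_neg, neg_zero]
      rintro ⟨⟩
    · rw [LinearMap.flip_apply, h.inr_inl, LinearMap.neg_apply, Module.Basis.coord_apply,
        Module.Basis.repr_self, Finsupp.single_apply]
      by_cases hij : i = j
      · subst hij
        simp only [Fin.ext_iff, true_and, Sigma.mk.injEq, heq_eq_eq, Sum.inr.injEq]
        split_ifs <;> simp
      · simp [hij]
  rw [← LinearMap.neg_apply, ← this, LinearMap.flip_apply]

theorem eq_zero_of_apply {u : V} (hu : ∀ v, ω u v = 0) : u = 0 := by
  refine b.ext_elem fun p => ?_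
  obtain ⟨j, t | t⟩ := p
  · have := h.apply_inr u j t
    rw [hu] at this
    simpa using this.symm
  · have := h.apply_inl u j t
    rw [hu] at this
    simpa using this

theorem isSelfAdjointPair : IsSelfAdjointPair ω (shift b) where
  alt := h.alt
  nondegenerate := by
    refine ⟨fun u hu => h.eq_zero_of_apply hu, fun u hu => h.eq_zero_of_apply fun v => ?_⟩
    rw [← h.alt.neg_eq, hu, neg_zero]
  selfAdjoint u v := by
    rw [h.shift_apply, ← h.alt'.neg_eq, ← h.shift_apply, h.alt.neg_eq]

omit h in
theorem finrank_eq (b : Module.Basis (Σ j : Fin N, Fin (n j) ⊕ Fin (n j)) K V) :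
    Module.finrank K V = 2 * ∑ j, n j := by
  rw [Module.finrank_eq_card_basis b, Fintype.card_sigma, Finset.mul_sum]
  exact Finset.sum_congr rfl fun j _ => by simp [two_mul]

/-- The generator of the first half of the block `j`. -/
noncomputable def genLeft (b : Module.Basis (Σ j : Fin N, Fin (n j) ⊕ Fin (n j)) K V)
    (j : Fin N) : V := if h : 0 < n j then b ⟨j, .inl ⟨0, h⟩⟩ else 0

/-- The generator of the second half of the block `j`. -/
noncomputable def genRight (b : Module.Basis (Σ j : Fin N, Fin (n j) ⊕ Fin (n j)) K V)
    (j : Fin N) : V := if h : 0 < n j then b ⟨j, .inr ⟨n j - 1, by omega⟩⟩ else 0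

omit h in
theorem pow_genLeft (s : ℕ) (j : Fin N) : (shift b ^ s) (genLeft b j) =
    if h : s < n j then b ⟨j, .inl ⟨s, h⟩⟩ else 0 := by
  induction s with
  | zero => simp [genLeft]
  | succ s ih =>
    rw [pow_succ', Module.End.mul_apply, ih]
    by_cases hs : s < n j
    · rw [dif_pos hs, shift_inl]
    · rw [dif_neg hs, dif_neg (by omega), map_zero]

omit h in
theorem pow_genRight (s : ℕ) (j : Fin N) : (shift b ^ s) (genRight b j) =
    if h : s < n j then b ⟨j, .inr ⟨n j - 1 - s, by omega⟩⟩ else 0 := by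
  induction s with
  | zero => simp [genRight]
  | succ s ih =>
    rw [pow_succ', Module.End.mul_apply, ih]
    by_cases hs : s < n j
    · rw [dif_pos hs, shift_inr]
      by_cases hs' : s + 1 < n j
      · rw [if_pos (by simp only; omega), dif_pos hs']
        congr 3
      · rw [if_neg (by simp only; omega), dif_neg hs']
    · rw [dif_neg hs, dif_neg (by omega), map_zero]

theorem isJordanFrame : IsJordanFrame ω (shift b) ⊥ n (genLeft b) (genRight b) where
  isotropic u hu v _ := by rw [(Submodule.mem_bot K).1 hu]; simp
  stable u hu := by rw [(Submodule.mem_bot K).1 hu]; simp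
  perp_left z hz i := by rw [(Submodule.mem_bot K).1 hz]; simp
  perp_right z hz i := by rw [(Submodule.mem_bot K).1 hz]; simp
  pow_left i := by simp [pow_genLeft]
  pow_right i := by simp [pow_genRight]
  pair s i j := by
    rw [pow_genLeft, genRight]
    by_cases hij : i = j
    · subst hij
      by_cases hs : s < n i
      -- `shift` raises indices in the first half and lowers them in the second, so `genRight` sits
      -- at the top index `n i - 1`.
      · rw [dif_pos hs, dif_pos (by omega), h.inl_inr]
        have : s = n i - 1 ↔ s + 1 = n i := by omega
        simp [this]
      · rw [dif_neg hs, if_neg (by omega)]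
        simp
    · rw [if_neg fun h' => hij h'.1]
      split_ifs <;> simp [h.inl_inr, hij]
  pair_left s i j := by
    rw [pow_genLeft, genLeft]
    split_ifs <;> simp [h.inl_inl]
  pair_right s i j := by
    rw [pow_genRight, genRight]
    split_ifs <;> simp [h.inr_inr]
  finrank_eq := by rw [finrank_bot, zero_add, finrank_eq b]

end IsJordanBasis

end JordanBasis

/-! ### Graphs of symmetric forms, and the dimension formula. -/

section JordanBasis

variable {K V : Type*} [Field K] [AddCommGroup V] [Module K V] {N : ℕ} {n : Fin N → ℕ}

theorem apply_eq_zero_of_mem_span {β : LinearMap.BilinForm K V} {κ : Type*} {v : κ → V}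
    (h : ∀ c c', β (v c) (v c') = 0) {u w : V} (hu : u ∈ Submodule.span K (Set.range v))
    (hw : w ∈ Submodule.span K (Set.range v)) : β u w = 0 := by
  have h1 : Submodule.span K (Set.range v) ≤ LinearMap.ker (LinearMap.flip β w) := by
    refine Submodule.span_le.2 ?_
    rintro _ ⟨c, rfl⟩
    have h2 : Submodule.span K (Set.range v) ≤ LinearMap.ker (β (v c)) := by
      refine Submodule.span_le.2 ?_
      rintro _ ⟨c', rfl⟩
      exact h c c'
    exact h2 hw
  exact h1 hu

theorem SkewPencil.rank_eq_finrank [FiniteDimensional K V] {P : SkewPencil K V} {μ : OnePoint K}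
    (h : ∀ u, (∀ v, P.form μ u v = 0) → u = 0) : P.rank = Module.finrank K V := by
  have hle : ∀ ν, Module.finrank K (LinearMap.range (P.form ν)) ≤ Module.finrank K V :=
    fun ν => LinearMap.finrank_range_le _
  refine le_antisymm (ciSup_le' hle) ?_
  have hker : LinearMap.ker (P.form μ) = ⊥ :=
    LinearMap.ker_eq_bot'.2 fun u hu => h u fun v => by rw [hu]; rfl
  have h1 := LinearMap.finrank_range_add_finrank_ker (P.form μ)
  rw [hker, finrank_bot, add_zero] at h1
  rw [← h1]
  exact le_ciSup (f := fun ν => Module.finrank K (LinearMap.range (P.form ν)))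
    ⟨_, Set.forall_mem_range.2 hle⟩ μ

namespace IsJordanBasis

variable {ω η : LinearMap.BilinForm K V}
  {b : Module.Basis (Σ j : Fin N, Fin (n j) ⊕ Fin (n j)) K V} (h : IsJordanBasis ω η b)

-- For `u, v ∈ L`, `ω(v, x u) = η(v, u) = 0`, so `x u` is orthogonal to `L`, and `L` is its own
-- orthogonal by dimension.
include h in
theorem isInvariantLagrangian [FiniteDimensional K V] {L : Submodule K V}
    (hL : ∀ u ∈ L, ∀ v ∈ L, ω u v = 0 ∧ η u v = 0)
    (hdim : 2 * Module.finrank K L = Module.finrank K V) :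
    IsInvariantLagrangian ω (shift b) L where
  isotropic u hu v hv := (hL u hu v hv).1
  stable u hu := by
    have hle : L ≤ LinearMap.BilinForm.orthogonal ω L := fun u hu v hv => (hL v hv u hu).1
    have heq : L = LinearMap.BilinForm.orthogonal ω L := by
      refine Submodule.eq_of_le_of_finrank_eq hle ?_
      rw [LinearMap.BilinForm.finrank_orthogonal h.isSelfAdjointPair.nondegenerate]
      omega
    rw [heq]
    intro v hv
    change ω v (shift b u) = 0
    rw [← h.isSelfAdjointPair.selfAdjoint, h.shift_apply]
    exact (hL v hv u hu).2
  finrank_eq := hdim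

/-- Parameters of the symmetric `K[x]`-bilinear forms on `⨁ K[x] / x ^ n j`. -/
abbrev SymParam (n : Fin N → ℕ) : Type := Σ j : Fin N, Fin (j + 1) × Fin (n j)

/-- The Hankel coefficients of the symmetric form with parameters `a`, for `i ≤ j`. -/
def symCoeff (a : SymParam n → K) (i j : Fin N) (r : ℕ) : K :=
  if h : r < n j ∧ i ≤ j then a ⟨j, ⟨i, Nat.lt_succ_of_le h.2⟩, ⟨r, h.1⟩⟩ else 0

/-- The Hankel coefficients of the symmetric form with parameters `a`. -/
def hankel (a : SymParam n → K) (i j : Fin N) (r : ℕ) : K := symCoeff a (min i j) (max i j) r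

theorem hankel_comm (a : SymParam n → K) (i j : Fin N) (r : ℕ) :
    hankel a i j r = hankel a j i r := by
  rw [hankel, hankel, min_comm, max_comm]

theorem hankel_eq_zero (hn : Antitone n) (a : SymParam n → K) {i j : Fin N} {r : ℕ}
    (hr : n j ≤ r) : hankel a i j r = 0 :=
  dif_neg fun h => not_lt.2 ((hn (le_max_right i j)).trans hr) h.1

/-- The graph of a symmetric form, over the first half of the basis. -/
noncomputable def graphVector
    (b : Module.Basis (Σ j : Fin N, Fin (n j) ⊕ Fin (n j)) K V) (a : SymParam n → K)
    (p : Σ j, Fin (n j)) : V :=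
  b ⟨p.1, .inl p.2⟩ +
    ∑ q : Σ j, Fin (n j), hankel a p.1 q.1 (p.2 + q.2) • b ⟨q.1, .inr q.2⟩

-- The two mixed terms cancel by the symmetry of the Hankel coefficients.
include h in
theorem apply_graphVector (a : SymParam n → K) (p q : Σ j, Fin (n j)) :
    ω (graphVector b a p) (graphVector b a q) = 0 := by
  obtain ⟨i, s⟩ := p
  obtain ⟨j, t⟩ := q
  have h1 : ω (b ⟨i, .inl s⟩)
      (∑ q : Σ j, Fin (n j), hankel a j q.1 (t + q.2) • b ⟨q.1, .inr q.2⟩) =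
      hankel a j i (t + s) := by
    rw [map_sum, Finset.sum_eq_single ⟨i, s⟩]
    · simp [h.inl_inr]
    · rintro ⟨k, r⟩ - hk
      rw [map_smul, h.inl_inr, if_neg, smul_zero]
      rintro ⟨rfl, hr⟩
      exact hk (by rw [Fin.ext hr])
    · exact fun hk => absurd (Finset.mem_univ _) hk
  have h2 : ω (∑ q : Σ j, Fin (n j), hankel a i q.1 (s + q.2) • b ⟨q.1, .inr q.2⟩)
      (b ⟨j, .inl t⟩) = -hankel a i j (s + t) := by
    rw [map_sum, LinearMap.sum_apply, Finset.sum_eq_single ⟨j, t⟩]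
    · simp [h.inr_inl]
    · rintro ⟨k, r⟩ - hk
      rw [map_smul, LinearMap.smul_apply, h.inr_inl, if_neg, smul_zero]
      rintro ⟨hkj, hr⟩
      simp only at hkj hr
      subst hkj
      exact hk (by rw [Fin.ext hr])
    · exact fun hk => absurd (Finset.mem_univ _) hk
  have h3 : ω (∑ q : Σ j, Fin (n j), hankel a i q.1 (s + q.2) • b ⟨q.1, .inr q.2⟩)
      (∑ q : Σ j, Fin (n j), hankel a j q.1 (t + q.2) • b ⟨q.1, .inr q.2⟩) = 0 := by
    simp [h.inr_inr]
  simp only [graphVector, map_add, LinearMap.add_apply, h1, h2, h3, h.inl_inl]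
  rw [hankel_comm a j i, add_comm (t : ℕ)]
  ring

-- Both mixed terms involve the coefficient at `s + t + 1`, because the entries depend on the sum of
-- the indices only; this is linearity over `K[x]`. When `s + 1 = n i` the partner vector is
-- missing, and the coefficient is zero since for decreasing `n` it is supported below `min (n i) (n
-- j)`.
include h in
theorem apply_graphVector' (hn : Antitone n) (a : SymParam n → K) (p q : Σ j, Fin (n j)) :
    η (graphVector b a p) (graphVector b a q) = 0 := by
  obtain ⟨i, s⟩ := p
  obtain ⟨j, t⟩ := q
  have h0 : ∀ (i j : Fin N) (s : Fin (n i)) (t : Fin (n j)), η (b ⟨i, .inl s⟩)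
      (∑ q : Σ j, Fin (n j), hankel a j q.1 (t + q.2) • b ⟨q.1, .inr q.2⟩) =
      hankel a j i (t + (s + 1)) := by
    intro i j s t
    rw [map_sum]
    by_cases hs : (s : ℕ) + 1 < n i
    · rw [Finset.sum_eq_single ⟨i, ⟨s + 1, hs⟩⟩]
      · simp [h.inl_inr']
      · rintro ⟨k, r⟩ - hk
        rw [map_smul, h.inl_inr', if_neg, smul_zero]
        rintro ⟨rfl, hr⟩
        exact hk (by congr 1; exact Fin.ext hr.symm)
      · exact fun hk => absurd (Finset.mem_univ _) hk
    · rw [hankel_eq_zero hn a (by omega)]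
      refine Finset.sum_eq_zero ?_
      rintro ⟨k, r⟩ -
      rw [map_smul, h.inl_inr', if_neg, smul_zero]
      rintro ⟨rfl, hr⟩
      have := r.2
      simp only at hr
      omega
  have h3 : η (∑ q : Σ j, Fin (n j), hankel a i q.1 (s + q.2) • b ⟨q.1, .inr q.2⟩)
      (∑ q : Σ j, Fin (n j), hankel a j q.1 (t + q.2) • b ⟨q.1, .inr q.2⟩) = 0 := by
    simp [h.inr_inr']
  have h0' : η (∑ q : Σ j, Fin (n j), hankel a i q.1 (s + q.2) • b ⟨q.1, .inr q.2⟩)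
      (b ⟨j, .inl t⟩) = -hankel a i j (s + (t + 1)) := by
    rw [← h.alt'.neg_eq, h0]
  simp only [graphVector, map_add, LinearMap.add_apply, h0, h0', h3, h.inl_inl']
  rw [hankel_comm a j i, show (t : ℕ) + (s + 1) = s + (t + 1) by omega]
  ring

theorem coord_inl_graphVector (a : SymParam n → K) (p q : Σ j, Fin (n j)) :
    b.coord ⟨q.1, .inl q.2⟩ (graphVector b a p) = if p = q then 1 else 0 := by
  obtain ⟨j, t⟩ := q
  have h1 : ∀ p : Σ j, Fin (n j),
      b.coord ⟨j, .inl t⟩ (b ⟨p.1, .inl p.2⟩) = if p = ⟨j, t⟩ then 1 else 0 := by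
    rintro ⟨i, s⟩
    rw [Module.Basis.coord_apply, Module.Basis.repr_self, Finsupp.single_apply]
    by_cases hij : i = j
    · subst hij; simp
    · simp [hij]
  have h2 : ∀ p : Σ j, Fin (n j), b.coord ⟨j, .inl t⟩ (b ⟨p.1, .inr p.2⟩) = 0 := by
    rintro ⟨i, s⟩
    rw [Module.Basis.coord_apply, Module.Basis.repr_self, Finsupp.single_apply, if_neg]
    rintro ⟨⟩
  simp only [graphVector, map_add, h1, map_sum, map_smul, h2, smul_zero, Finset.sum_const_zero,
    add_zero]

theorem coord_inr_graphVector (a : SymParam n → K) (p q : Σ j, Fin (n j)) :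
    b.coord ⟨q.1, .inr q.2⟩ (graphVector b a p) = hankel a p.1 q.1 (p.2 + q.2) := by
  obtain ⟨j, t⟩ := q
  have h1 : ∀ p : Σ j, Fin (n j),
      b.coord ⟨j, .inr t⟩ (b ⟨p.1, .inr p.2⟩) = if p = ⟨j, t⟩ then 1 else 0 := by
    rintro ⟨i, s⟩
    rw [Module.Basis.coord_apply, Module.Basis.repr_self, Finsupp.single_apply]
    by_cases hij : i = j
    · subst hij; simp
    · simp [hij]
  have h2 : ∀ p : Σ j, Fin (n j), b.coord ⟨j, .inr t⟩ (b ⟨p.1, .inl p.2⟩) = 0 := by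
    rintro ⟨i, s⟩
    rw [Module.Basis.coord_apply, Module.Basis.repr_self, Finsupp.single_apply, if_neg]
    rintro ⟨⟩
  simp only [graphVector, map_add, h1, map_sum, map_smul, h2, smul_eq_mul, mul_ite, mul_one,
    mul_zero, Finset.sum_ite_eq', Finset.mem_univ, if_true, zero_add]

end IsJordanBasis

/-- The dimension of the bi-Lagrangian Grassmannian of a Jordan sum, over an infinite field. -/
theorem SkewPencil.IsJordanSum.topologicalKrullDim_eq [Infinite K] {P : SkewPencil K V}
    {lam : OnePoint K} (hn : Antitone n) (hP : P.IsJordanSum lam n) :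
    topologicalKrullDim P.BLG = ((∑ j : Fin N, ((j : ℕ) + 1) * n j : ℕ) : WithBot ℕ∞) := by
  obtain ⟨ω, η, b, hb, ⟨μ, hμ⟩, hiso⟩ := hP.exists_isJordanBasis
  have : FiniteDimensional K V := b.finiteDimensional_of_finite
  have hdim := IsJordanBasis.finrank_eq b
  have hrank : P.rank = Module.finrank K V :=
    SkewPencil.rank_eq_finrank (μ := μ) fun u hu => hb.eq_zero_of_apply fun v => hμ ▸ hu v
  have hk : P.lagDim = ∑ j, n j := by
    rw [SkewPencil.lagDim, hrank, hdim]
    omega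
  refine le_antisymm ?_ ?_
  · refine SkewPencil.krullDim_le_of_isParametrized ?_
    rw [hk]
    refine (isParametrized_of_frame hb.isSelfAdjointPair hb.isJordanFrame
      (two_mul_sum_eq_lagWeight hn)).mono fun L hL => ?_
    refine hb.isInvariantLagrangian ((hiso L).1 hL.1) ?_
    have := hL.2
    omega
  · have hcard : Fintype.card (IsJordanBasis.SymParam n) = ∑ j : Fin N, ((j : ℕ) + 1) * n j := by
      simp [Fintype.card_sigma]
    let g : IsJordanBasis.SymParam n ≃ Fin (∑ j : Fin N, ((j : ℕ) + 1) * n j) :=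
      Fintype.equivFinOfCardEq hcard
    let q : Fin P.lagDim ≃ Σ j, Fin (n j) :=
      (Fintype.equivFinOfCardEq (by rw [hk]; simp [Fintype.card_sigma])).symm
    let ψ : V →ₗ[K] (Fin P.lagDim → K) := LinearMap.pi fun c => b.coord ⟨(q c).1, .inl (q c).2⟩
    have hψ : ∀ (t : Fin (∑ j : Fin N, ((j : ℕ) + 1) * n j) → K) c,
        ψ (IsJordanBasis.graphVector b (t ∘ g) (q c)) = Pi.single c 1 := by
      intro t c
      ext c'
      rw [LinearMap.pi_apply, IsJordanBasis.coord_inl_graphVector, Pi.single_apply]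
      simp [eq_comm]
    -- The parameter `(j, i, r)` is read off over the generator of block `i`, at index `0`, as the
    -- coordinate at `inr r` in block `j`. That generator exists because `n i ≥ n j > r`.
    have hpos : ∀ r : IsJordanBasis.SymParam n,
        0 < n ⟨r.2.1, r.2.1.2.trans_le r.1.2⟩ := fun r =>
      (Nat.zero_le _).trans_lt (r.2.2.2.trans_le (hn (Nat.le_of_lt_succ r.2.1.2)))
    refine SkewPencil.le_krullDim_of_polynomial_family
      (Φ := fun t c => IsJordanBasis.graphVector b (t ∘ g) (q c)) ?_ (fun t => ⟨?_, ?_⟩) ψ hψ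
      (fun m => (b.coord ⟨(g.symm m).1, .inr (g.symm m).2.2⟩).comp
        (LinearMap.proj (R := K) (φ := fun _ : Fin P.lagDim => V)
          (q.symm ⟨⟨(g.symm m).2.1, (g.symm m).2.1.2.trans_le (g.symm m).1.2⟩,
            ⟨0, hpos (g.symm m)⟩⟩))) ?_
    · refine IsPolyMap.pi fun c => (isPolyMap_const _).add (IsPolyMap.sum _ fun p _ =>
        IsPolyMap.smul ?_ (isPolyMap_const _))
      simp only [IsJordanBasis.hankel, IsJordanBasis.symCoeff]
      split_ifs
      · exact coord_mem_polyFun _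
      · exact const_mem_polyFun 0
    · rw [hiso]
      exact fun u hu v hv =>
        ⟨apply_eq_zero_of_mem_span (fun c c' => hb.apply_graphVector _ _ _) hu hv,
          apply_eq_zero_of_mem_span (fun c c' => hb.apply_graphVector' hn _ _ _) hu hv⟩
    · have hli : LinearIndependent K fun c => IsJordanBasis.graphVector b (t ∘ g) (q c) :=
        linearIndependent_of_det_ne_zero (ψ := ψ) (by
          rw [chartMatrix_eq_one (hψ t), Matrix.det_one]; exact one_ne_zero)
      rw [finrank_span_eq_card hli, Fintype.card_fin, hrank, hk, hdim]
      omega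
    · intro m t
      obtain ⟨r, rfl⟩ := g.surjective m
      obtain ⟨j, i, s⟩ := r
      have hij : (⟨i, i.2.trans_le j.2⟩ : Fin N) ≤ j := Nat.le_of_lt_succ i.2
      rw [LinearMap.comp_apply, LinearMap.proj_apply, Equiv.symm_apply_apply,
        Equiv.apply_symm_apply]
      refine (IsJordanBasis.coord_inr_graphVector (b := b) (t ∘ g) _ ⟨j, s⟩).trans ?_
      simp only [IsJordanBasis.hankel, min_eq_left hij, max_eq_right hij, zero_add]
      exact dif_pos ⟨s.2, hij⟩

end JordanBasis

theorem theoremT {K V : Type*} [RCLike K] [AddCommGroup V] [Module K V]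
    (P : SkewPencil K V) (lam : OnePoint K) (N : ℕ) (n : Fin N → ℕ) (hn : Antitone n)
    (hP : P.IsJordanSum lam n) :
    topologicalKrullDim P.BLG = ((∑ j : Fin N, ((j : ℕ) + 1) * n j : ℕ) : WithBot ℕ∞) := by
  have : Infinite K := Infinite.of_injective _ (Nat.cast_injective (R := K))
  exact hP.topologicalKrullDim_eq hn
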